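/- Let $n\ge 1$ and $0<q<1$. Write $\mathbb R^{n+1}_+=\{(x,y): x\in\mathbb R^n,\ y>0\}$, let $$P(x,y)=\frac{\Gamma(\frac{n+1}{2})}{\pi^{\frac{n+1}{2}}}\,\frac{y}{(|x|^2+y^2)^{\frac{n+1}{2}}}$$ be its Poisson kernel, and for Borel measures $\nu\ge 0$ on $\mathbb R^n$ and $\mu\ge 0$ on $\mathbb R^{n+1}_+$ put $$\mathbf P\nu(x,y)=\int_{\mathbb R^n}P(x-t,y)\,d\nu(t),\qquad \mathbf P^*\mu(t)=\int_{\mathbb R^{n+1}_+}P(x-t,y)\,d\mu(x,y),\qquad \mathbf P\mathbf P^*\mu=\mathbf P\big[(\mathbf P^*\mu)\,dt\big],$$ with values in $[0,\infty]$. (a) Let $\sigma$ be a nonnegative locally finite Borel measure on $\mathbb R^{n+1}_+$. There is a constant $\varkappa>0$ such that $$\|\mathbf P\nu\|_{L^q(\mathbb R^{n+1}_+,\sigma)}\le \varkappa\,\nu(\mathbb R^n)\quad\text{for all nonnegative locally finite Borel measures }\nu\text{ on }\mathbb R^n \tag{1}$$ if and only if there is a function $u:\mathbb R^{n+1}_+\to[0,\infty]$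 with $u>0$ $\sigma$-a.e., $u\in L^q(\mathbb R^{n+1}_+,\sigma)$ and $u\ge \mathbf P\mathbf P^*(u^q\sigma)$ everywhere in $\mathbb R^{n+1}_+$. (b) There is a constant $c_1>0$ depending only on $q$ and $n$ such that, for every $0<c_0\le c_1$ and every nonnegative locally finite Borel measure $\sigma$ on $\mathbb R^{n+1}_+$ for which (1) holds with some $\varkappa>0$, the functions $$u_0=c_0\,(\mathbf P\mathbf P^*\sigma)^{\frac1{1-q}},\qquad u_{j+1}=\mathbf P\mathbf P^*(u_j^q\sigma)\quad (j=0,1,2,\dots)$$ satisfy $u_j\le u_{j+1}$ for all $j$, and their pointwise limit $u=\lim_{j\to\infty}u_j$ satisfies $u=\mathbf P\mathbf P^*(u^q\sigma)$ and $u<\infty$ everywhere in $\mathbb R^{n+1}_+$, $u\in L^q(\mathbb R^{n+1}_+,\sigma)$ and $u\ge c_0(\mathbf P\mathbf P^*\sigma)^{\frac1{1-q}}$; moreover $u>0$ everywhere in $\mathbb R^{n+1}_+$ if $\sigma\ne0$. -/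

import Mathlib

open MeasureTheory Filter Topology
open scoped ENNReal NNReal

noncomputable section

namespace PoissonCarleson

/-- The open upper half-space: pairs `(x, y)` with `x ∈ ℝⁿ` and `y > 0`. -/
abbrev HalfSpace (n : ℕ) : Type := EuclideanSpace ℝ (Fin n) × Set.Ioi (0 : ℝ)

/-- The Poisson kernel of the upper half-space, with total mass one on each horizontal slice:
`P(x, y) = Γ((n+1)/2) π^{-(n+1)/2} y (|x|² + y²)^{-(n+1)/2}`. -/
def kernel {n : ℕ} (x : EuclideanSpace ℝ (Fin n)) (y : ℝ) : ℝ :=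
  Real.Gamma (((n : ℝ) + 1) / 2) / Real.pi ^ (((n : ℝ) + 1) / 2) *
    (y / (‖x‖ ^ 2 + y ^ 2) ^ (((n : ℝ) + 1) / 2))

/-- The Poisson integral `Pν(x, y) = ∫ P(x - t, y) dν(t)`. -/
def poisson {n : ℕ} (ν : Measure (EuclideanSpace ℝ (Fin n))) (z : HalfSpace n) : ℝ≥0∞ :=
  ∫⁻ t, ENNReal.ofReal (kernel (z.1 - t) (z.2 : ℝ)) ∂ν

/-- The formal adjoint (balayage) `P*μ(t) = ∫ P(x - t, y) dμ(x, y)`. -/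
def balayage {n : ℕ} (μ : Measure (HalfSpace n)) (t : EuclideanSpace ℝ (Fin n)) : ℝ≥0∞ :=
  ∫⁻ z, ENNReal.ofReal (kernel (z.1 - t) (z.2 : ℝ)) ∂μ

/-- The symmetrized potential `PP*μ = P[(P*μ) dt]`. -/
def symPotential {n : ℕ} (μ : Measure (HalfSpace n)) (z : HalfSpace n) : ℝ≥0∞ :=
  poisson (volume.withDensity (balayage μ)) z

/-- The measure `u^q σ`. -/
def powMeasure {n : ℕ} (q : ℝ) (σ : Measure (HalfSpace n)) (u : HalfSpace n → ℝ≥0∞) :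
    Measure (HalfSpace n) :=
  σ.withDensity (fun z => u z ^ q)

/-- The `(1, q)`-Carleson measure inequality: for some constant `κ > 0`,
`‖Pν‖_{L^q(σ)} ≤ κ ν(ℝⁿ)` for all locally finite Borel measures `ν` on `ℝⁿ`. -/
def CarlesonInequality {n : ℕ} (q : ℝ) (σ : Measure (HalfSpace n)) : Prop :=
  ∃ κ : ℝ≥0, 0 < κ ∧
    ∀ (ν : Measure (EuclideanSpace ℝ (Fin n))) [IsLocallyFiniteMeasure ν],
      eLpNorm (poisson ν) (ENNReal.ofReal q) σ ≤ (κ : ℝ≥0∞) * ν Set.univ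

/-- A positive supersolution in `L^q(σ)`: `u > 0` almost everywhere for `σ`, `u ∈ L^q(σ)` (so that
also `u < ∞` almost everywhere), and `u ≥ PP*(u^q σ)` at every point of the half-space. -/
structure IsPositiveSupersolution {n : ℕ} (q : ℝ) (σ : Measure (HalfSpace n))
    (u : HalfSpace n → ℝ≥0∞) : Prop where
  pos : ∀ᵐ z ∂σ, 0 < u z
  memLp : MemLp u (ENNReal.ofReal q) σ
  le : ∀ z, symPotential (powMeasure q σ u) z ≤ u z

/-- The iterates `u₀ = c₀ (PP*σ)^{1/(1-q)}`, `u_{j+1} = PP*(u_j^q σ)`. -/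
def iterates {n : ℕ} (q : ℝ) (c₀ : ℝ≥0) (σ : Measure (HalfSpace n)) : ℕ → HalfSpace n → ℝ≥0∞
  | 0 => fun z => (c₀ : ℝ≥0∞) * symPotential σ z ^ (1 / (1 - q))
  | j + 1 => symPotential (powMeasure q σ (iterates q c₀ σ j))

end PoissonCarleson

end

/-!
Write `K(z, w) = ∫ P(z, t) P(w, t) dt` for the kernel of `PP*`. The exact form of `K` is irrelevant:
everything rests on elementary estimates for `P` that are uniform up to constants depending on `n`,
namely a bound for `∫ P(z, t) dt`, a Harnack inequality, and `P(w, t) ≤ h K(z, w)` whenever `z` is,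
up to a factor `2`, at least as close to the boundary point `t` as `w`
(`exists_pker_le_symKernel`). The last one yields the weak maximum principle
`balayage_le_of_symPotential_le`: if `PP*μ ≤ l` on a set that carries `μ` and stays away
from the boundary, then `P*μ ≤ h l` on `ℝⁿ`.

*Solutions from the Carleson inequality.* Splitting `σ` according to the size of `PP*σ`, the maximum
principle gives `(PP*σ)^s ≤ C PP*((PP*σ)^{s-1} σ)` for `s ≥ 1` (`rpow_symPotential_le`). With
`s = 1/(1-q)` this says that `c (PP*σ)^s` is a subsolution for small `c`
(`exists_const_subsolution`), so that the iterates increase. Testing the Carleson inequality with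
`ν = P*(v^q σ) dt` for a subsolution `v` shows that `A = ∫ v^q dσ` satisfies `A ≤ (κ b A)^q`, which
bounds `A` as soon as it is finite; finiteness for `u₀` follows by truncating `σ`. Monotone
convergence then gives a solution in `L^q(σ)`, which is finite because `K(z, ·)` is bounded.

*The Carleson inequality from a supersolution.* Let `μ = u^q σ`, a finite measure. Since
`u ≥ PP*μ`, it suffices to bound `Pν / PP*μ` in `L^q(μ)`, and, as `q < 1`, a weak-type `(1, 1)`
bound with respect to `μ` is enough (`lintegral_rpow_le_of_weakType`). For the latter (`weakType`)
Harnack's inequality allows one to replace `μ` on the set `{l PP*μ ≤ Pν}` by finitely many point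
masses. A finite set of points carries an equilibrium measure `m`, with `PP*m ≥ 1` on the set and
`PP*m ≤ 1` on the support of `m` (`exists_equilibrium`, a quadratic minimization); then `P*m ≤ h` by
the maximum principle, and integrating `l PP*μ ≤ Pν` against `m` bounds `l` times the mass of `μ` on
that set by a multiple of `h ν(ℝⁿ)`.
-/

noncomputable section

namespace PoissonCarleson

variable {n : ℕ}

/-! ### Pointwise estimates for the Poisson kernel -/

/-- The normalizing constant of the Poisson kernel. -/
def kernelConst (n : ℕ) : ℝ :=
  Real.Gamma (((n : ℝ) + 1) / 2) / Real.pi ^ (((n : ℝ) + 1) / 2)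

lemma kernelConst_pos (n : ℕ) : 0 < kernelConst n :=
  div_pos (Real.Gamma_pos_of_pos (by positivity)) (by positivity)

lemma kernel_eq (x : EuclideanSpace ℝ (Fin n)) (y : ℝ) :
    kernel x y = kernelConst n * (y / √(‖x‖ ^ 2 + y ^ 2) ^ (n + 1)) := by
  unfold kernel kernelConst
  have h : (0 : ℝ) ≤ ‖x‖ ^ 2 + y ^ 2 := by positivity
  rw [Real.sqrt_eq_rpow, ← Real.rpow_natCast (_ ^ (1 / 2 : ℝ)), ← Real.rpow_mul h]
  congr 4
  push_cast
  ring

lemma le_kernel (x : EuclideanSpace ℝ (Fin n)) {y : ℝ} (hy : 0 < y) :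
    kernelConst n * (y / (‖x‖ + y) ^ (n + 1)) ≤ kernel x y := by
  rw [kernel_eq]
  have hc := kernelConst_pos n
  have h1 : √(‖x‖ ^ 2 + y ^ 2) ≤ ‖x‖ + y := by
    rw [Real.sqrt_le_left (by positivity)]
    nlinarith [norm_nonneg x, mul_nonneg (norm_nonneg x) hy.le]
  have h0 : 0 < √(‖x‖ ^ 2 + y ^ 2) := by positivity
  gcongr

lemma kernel_le (x : EuclideanSpace ℝ (Fin n)) {y : ℝ} (hy : 0 < y) :
    kernel x y ≤ kernelConst n * 2 ^ (n + 1) * (y / (‖x‖ + y) ^ (n + 1)) := by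
  rw [kernel_eq, mul_assoc]
  have hc := kernelConst_pos n
  have h0 : 0 < √(‖x‖ ^ 2 + y ^ 2) := by positivity
  have h1 : ‖x‖ + y ≤ 2 * √(‖x‖ ^ 2 + y ^ 2) := by
    have : (‖x‖ + y) / 2 ≤ √(‖x‖ ^ 2 + y ^ 2) := by
      apply Real.le_sqrt_of_sq_le
      nlinarith [sq_nonneg (‖x‖ - y), sq_nonneg (‖x‖ + y)]
    linarith
  have hd : 0 < ‖x‖ + y := by positivity
  have h2 : (‖x‖ + y) ^ (n + 1) ≤ 2 ^ (n + 1) * √(‖x‖ ^ 2 + y ^ 2) ^ (n + 1) := by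
    rw [← mul_pow]; gcongr
  refine mul_le_mul_of_nonneg_left ?_ hc.le
  rw [← mul_div_assoc, div_le_div_iff₀ (by positivity) (by positivity)]
  nlinarith

lemma kernel_pos (x : EuclideanSpace ℝ (Fin n)) {y : ℝ} (hy : 0 < y) : 0 < kernel x y := by
  have hd : 0 < ‖x‖ + y := by positivity
  have hc := kernelConst_pos n
  exact lt_of_lt_of_le (by positivity) (le_kernel x hy)

/-- The Poisson kernel `P(x - t, y)` as an extended nonnegative function of `z = (x, y)` and
`t`. -/
def pker (z : HalfSpace n) (t : EuclideanSpace ℝ (Fin n)) : ℝ≥0∞ :=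
  ENNReal.ofReal (kernel (z.1 - t) (z.2 : ℝ))

/-- The quantity `|x - t| + y`, comparable with the Euclidean distance from `z = (x, y)` to the
boundary point `(t, 0)`. -/
def bdist (z : HalfSpace n) (t : EuclideanSpace ℝ (Fin n)) : ℝ := ‖z.1 - t‖ + z.2

lemma height_pos (z : HalfSpace n) : 0 < (z.2 : ℝ) := z.2.2

lemma height_le_bdist (z : HalfSpace n) (t : EuclideanSpace ℝ (Fin n)) :
    (z.2 : ℝ) ≤ bdist z t := by
  unfold bdist; linarith [norm_nonneg (z.1 - t)]

lemma bdist_pos (z : HalfSpace n) (t : EuclideanSpace ℝ (Fin n)) : 0 < bdist z t :=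
  (height_pos z).trans_le (height_le_bdist z t)

lemma pker_pos (z : HalfSpace n) (t : EuclideanSpace ℝ (Fin n)) : 0 < pker z t :=
  ENNReal.ofReal_pos.2 (kernel_pos _ (height_pos z))

lemma measurable_pker : Measurable (fun a : HalfSpace n × EuclideanSpace ℝ (Fin n) =>
    pker a.1 a.2) := by
  unfold pker kernel
  fun_prop

lemma measurable_pker_right (z : HalfSpace n) : Measurable (pker z) :=
  measurable_pker.comp measurable_prodMk_left

lemma measurable_pker_left (t : EuclideanSpace ℝ (Fin n)) :
    Measurable (fun z : HalfSpace n => pker z t) :=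
  measurable_pker.comp measurable_prodMk_right

lemma le_pker (z : HalfSpace n) (t : EuclideanSpace ℝ (Fin n)) :
    ENNReal.ofReal (kernelConst n * (z.2 / bdist z t ^ (n + 1))) ≤ pker z t :=
  ENNReal.ofReal_le_ofReal (le_kernel _ (height_pos z))

lemma pker_le (z : HalfSpace n) (t : EuclideanSpace ℝ (Fin n)) :
    pker z t ≤ ENNReal.ofReal (kernelConst n * 2 ^ (n + 1) * (z.2 / bdist z t ^ (n + 1))) :=
  ENNReal.ofReal_le_ofReal (kernel_le _ (height_pos z))

lemma pker_le_of_height {δ : ℝ} (hδ : 0 < δ) {z : HalfSpace n} (hz : δ ≤ z.2)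
    (t : EuclideanSpace ℝ (Fin n)) :
    pker z t ≤ ENNReal.ofReal (kernelConst n * 2 ^ (n + 1) * (1 / δ ^ n)) := by
  refine (pker_le z t).trans (ENNReal.ofReal_le_ofReal ?_)
  have hc := kernelConst_pos n
  have hb := bdist_pos z t
  have hzb := height_le_bdist z t
  refine mul_le_mul_of_nonneg_left ?_ (by positivity)
  rw [div_le_div_iff₀ (by positivity) (by positivity), one_mul, pow_succ']
  have : δ ^ n ≤ bdist z t ^ n := by gcongr; linarith
  have := height_pos z
  gcongr

/-- A Harnack inequality for the Poisson kernel on balls of Whitney type. -/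
lemma pker_harnack (c : HalfSpace n) {z w : HalfSpace n} (hz : dist z c < c.2 / 8)
    (hw : dist w c < c.2 / 8) (t : EuclideanSpace ℝ (Fin n)) :
    pker z t ≤ ENNReal.ofReal (2 ^ (2 * n + 3)) * pker w t := by
  have hc := kernelConst_pos n
  have hy := height_pos c
  have h1 : dist z.1 c.1 < c.2 / 8 := (le_max_left _ _).trans_lt hz
  have h2 : dist w.1 c.1 < c.2 / 8 := (le_max_left _ _).trans_lt hw
  have h3 : |(z.2 : ℝ) - c.2| < c.2 / 8 := (le_max_right _ _).trans_lt hz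
  have h4 : |(w.2 : ℝ) - c.2| < c.2 / 8 := (le_max_right _ _).trans_lt hw
  rw [abs_lt] at h3 h4
  have hy2 : (z.2 : ℝ) ≤ 2 * w.2 := by linarith
  have hb : bdist w t ≤ 2 * bdist z t := by
    have h5 : ‖w.1 - t‖ ≤ ‖z.1 - t‖ + c.2 / 4 := by
      rw [← dist_eq_norm, ← dist_eq_norm]
      have := dist_triangle w.1 c.1 t
      have h6 := dist_triangle c.1 z.1 t
      rw [dist_comm c.1 z.1] at h6
      linarith
    unfold bdist
    linarith [norm_nonneg (z.1 - t)]
  refine (pker_le z t).trans (le_trans ?_ (mul_le_mul_right (le_pker w t) _))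
  rw [← ENNReal.ofReal_mul (by positivity)]
  apply ENNReal.ofReal_le_ofReal
  have hbz := bdist_pos z t
  have hbw := bdist_pos w t
  have hpow : bdist w t ^ (n + 1) ≤ 2 ^ (n + 1) * bdist z t ^ (n + 1) := by
    rw [← mul_pow]; gcongr
  have key : (z.2 : ℝ) / bdist z t ^ (n + 1) ≤ 2 ^ (n + 2) * (w.2 / bdist w t ^ (n + 1)) := by
    rw [← mul_div_assoc, div_le_div_iff₀ (by positivity) (by positivity)]
    calc (z.2 : ℝ) * bdist w t ^ (n + 1)
        ≤ (2 * w.2) * (2 ^ (n + 1) * bdist z t ^ (n + 1)) := by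
          have := height_pos w
          gcongr
      _ = _ := by ring
  calc kernelConst n * 2 ^ (n + 1) * (z.2 / bdist z t ^ (n + 1))
      ≤ kernelConst n * 2 ^ (n + 1) * (2 ^ (n + 2) * (w.2 / bdist w t ^ (n + 1))) := by gcongr
    _ = _ := by ring

/-! ### The symmetrized kernel -/

/-- The kernel `K(z, w) = ∫ P(z, t) P(w, t) dt` of the operator `PP*`. -/
def symKernel (z w : HalfSpace n) : ℝ≥0∞ := ∫⁻ t, pker z t * pker w t

lemma symKernel_comm (z w : HalfSpace n) : symKernel z w = symKernel w z := by
  simp only [symKernel, mul_comm]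

/-- The mass of the Poisson kernel on the slices is bounded by a constant independent of the
slice; that this mass is `1` plays no role. -/
lemma exists_lintegral_pker_le (n : ℕ) :
    ∃ b : ℝ≥0, 0 < b ∧ ∀ z : HalfSpace n, ∫⁻ t, pker z t ≤ b := by
  have hc := kernelConst_pos n
  set I : ℝ≥0∞ := ∫⁻ x : EuclideanSpace ℝ (Fin n),
    ENNReal.ofReal ((1 + ‖x‖) ^ (-((n : ℝ) + 1))) with hI
  have hIfin : I < ∞ := by
    refine finite_integral_one_add_norm ?_
    simp
  set B : ℝ≥0∞ := ENNReal.ofReal (kernelConst n * 2 ^ (n + 1)) * I with hB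
  have hBfin : B ≠ ∞ := ENNReal.mul_ne_top ENNReal.ofReal_ne_top hIfin.ne
  refine ⟨B.toNNReal + 1, by positivity, fun z => ?_⟩
  have hy := height_pos z
  -- The substitution `t = x - y s` reduces every slice to the slice at height one.
  have hsub : ∀ f : EuclideanSpace ℝ (Fin n) → ℝ≥0∞, Measurable f →
      ∫⁻ t, f (z.1 - t) = ENNReal.ofReal ((z.2 : ℝ) ^ n) * ∫⁻ s, f ((z.2 : ℝ) • s) := by
    intro f hf
    rw [lintegral_sub_left_eq_self]
    have h1 := Measure.map_addHaar_smul (volume : Measure (EuclideanSpace ℝ (Fin n))) hy.ne'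
    have h2 : ∫⁻ s, f ((z.2 : ℝ) • s) =
        ENNReal.ofReal |((z.2 : ℝ) ^ n)⁻¹| * ∫⁻ s, f s := by
      rw [← lintegral_map hf (measurable_const_smul _), h1, lintegral_smul_measure]
      simp
    rw [h2, ← mul_assoc, ← ENNReal.ofReal_mul (by positivity), abs_of_pos (by positivity),
      mul_inv_cancel₀ (by positivity)]
    simp
  calc ∫⁻ t, pker z t
      ≤ ∫⁻ t, ENNReal.ofReal (kernelConst n * 2 ^ (n + 1) *
          (z.2 / (‖z.1 - t‖ + z.2) ^ (n + 1))) := lintegral_mono (pker_le z)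
    _ = ENNReal.ofReal ((z.2 : ℝ) ^ n) * ∫⁻ s : EuclideanSpace ℝ (Fin n),
          ENNReal.ofReal (kernelConst n * 2 ^ (n + 1) *
          (z.2 / (‖(z.2 : ℝ) • s‖ + z.2) ^ (n + 1))) :=
        hsub (fun x => ENNReal.ofReal (kernelConst n * 2 ^ (n + 1) *
          (z.2 / (‖x‖ + z.2) ^ (n + 1)))) (by fun_prop)
    _ = B := by
        rw [hB, hI, ← lintegral_const_mul' _ _ ENNReal.ofReal_ne_top,
          ← lintegral_const_mul' _ _ ENNReal.ofReal_ne_top]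
        refine lintegral_congr fun s => ?_
        have hs : 0 < 1 + ‖s‖ := by positivity
        rw [← ENNReal.ofReal_mul (by positivity), ← ENNReal.ofReal_mul (by positivity)]
        congr 1
        rw [Real.rpow_neg hs.le, norm_smul, Real.norm_of_nonneg hy.le,
          show (n : ℝ) + 1 = ((n + 1 : ℕ) : ℝ) by push_cast; ring, Real.rpow_natCast,
          show (z.2 : ℝ) * ‖s‖ + z.2 = z.2 * (1 + ‖s‖) by ring, mul_pow]
        field_simp
        rw [pow_succ]
    _ ≤ ((B.toNNReal + 1 : ℝ≥0) : ℝ≥0∞) := by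
        rw [ENNReal.coe_add, ENNReal.coe_toNNReal hBfin]
        exact le_self_add

/-- The estimate behind the maximum principle: if, up to a factor `2`, the point `z` is at least as
close to the boundary point `t` as `w` is, then `P(w, t)` is controlled by `K(z, w)`. -/
lemma exists_pker_le_symKernel (n : ℕ) :
    ∃ h : ℝ≥0, 0 < h ∧ ∀ (z w : HalfSpace n) (t : EuclideanSpace ℝ (Fin n)),
      bdist z t ≤ 2 * bdist w t → pker w t ≤ h * symKernel z w := by
  have hc := kernelConst_pos n
  set V : ℝ≥0∞ := volume (Metric.ball (0 : EuclideanSpace ℝ (Fin n)) 1) with hV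
  have hV0 : 0 < V := Metric.measure_ball_pos _ _ one_pos
  have hVt : V ≠ ∞ := measure_ball_lt_top.ne
  have hVr : 0 < V.toReal := ENNReal.toReal_pos hV0.ne' hVt
  set k := kernelConst n with hk
  set H : ℝ := 6 ^ (n + 1) * (2 ^ (n + 1) / (k * V.toReal)) with hH
  have hHpos : 0 < H := by positivity
  refine ⟨H.toNNReal, Real.toNNReal_pos.2 hHpos, fun z w t hzw => ?_⟩
  have hz := height_pos z
  have hw := height_pos w
  have hbw := bdist_pos w t
  set D : ℝ := ‖z.1 - w.1‖ + z.2 + w.2 with hD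
  have hDpos : 0 < D := by positivity
  have hD3 : D ≤ 3 * bdist w t := by
    have h1 : ‖z.1 - w.1‖ ≤ ‖z.1 - t‖ + ‖w.1 - t‖ := by
      rw [← dist_eq_norm, ← dist_eq_norm, ← dist_eq_norm]; exact dist_triangle_right _ _ _
    have : D ≤ bdist z t + bdist w t := by unfold bdist; linarith
    linarith
  -- On the ball of radius `y_z` about `x_z` both kernels have explicit lower bounds.
  have hball : ∀ s ∈ Metric.ball z.1 (z.2 : ℝ),
      ENNReal.ofReal (k * (1 / (2 ^ (n + 1) * (z.2 : ℝ) ^ n)) * (k * (w.2 / D ^ (n + 1)))) ≤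
        pker z s * pker w s := by
    intro s hs
    rw [Metric.mem_ball, dist_comm, dist_eq_norm] at hs
    have hbz := bdist_pos z s
    have hbws := bdist_pos w s
    have h1 : bdist z s ≤ 2 * z.2 := by unfold bdist; linarith
    have h2 : bdist w s ≤ D := by
      have : ‖w.1 - s‖ ≤ ‖z.1 - w.1‖ + ‖z.1 - s‖ := by
        rw [← dist_eq_norm, ← dist_eq_norm, ← dist_eq_norm, dist_comm z.1 w.1]
        exact dist_triangle _ _ _
      unfold bdist; linarith
    rw [ENNReal.ofReal_mul (by positivity)]
    refine mul_le_mul' (le_trans (ENNReal.ofReal_le_ofReal ?_) (le_pker z s))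
      (le_trans (ENNReal.ofReal_le_ofReal ?_) (le_pker w s))
    · have : bdist z s ^ (n + 1) ≤ (2 * (z.2 : ℝ)) ^ (n + 1) := by gcongr
      refine mul_le_mul_of_nonneg_left ?_ hc.le
      rw [div_le_div_iff₀ (by positivity) (by positivity), one_mul]
      calc bdist z s ^ (n + 1) ≤ (2 * (z.2 : ℝ)) ^ (n + 1) := this
        _ = _ := by ring
    · gcongr
  have hsym : ENNReal.ofReal (k * (1 / (2 ^ (n + 1) * (z.2 : ℝ) ^ n)) * (k * (w.2 / D ^ (n + 1))))
      * volume (Metric.ball z.1 (z.2 : ℝ)) ≤ symKernel z w := by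
    rw [← setLIntegral_const]
    exact (setLIntegral_mono_ae' measurableSet_ball (ae_of_all _ hball)).trans
      (setLIntegral_le_lintegral _ _)
  rw [Measure.addHaar_ball_of_pos _ _ hz, ← hV, ← ENNReal.ofReal_toReal hVt,
    ← ENNReal.ofReal_mul (by positivity), ← ENNReal.ofReal_mul (by positivity)] at hsym
  refine (pker_le w t).trans (le_trans ?_ (mul_le_mul_right hsym _))
  change _ ≤ ENNReal.ofReal H * _
  rw [← ENNReal.ofReal_mul hHpos.le]
  apply ENNReal.ofReal_le_ofReal
  rw [finrank_euclideanSpace_fin]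
  have hpow : D ^ (n + 1) ≤ 3 ^ (n + 1) * bdist w t ^ (n + 1) := by
    rw [← mul_pow]; gcongr
  have e : H * (k * (1 / (2 ^ (n + 1) * (z.2 : ℝ) ^ n)) * (k * (w.2 / D ^ (n + 1))) *
      ((z.2 : ℝ) ^ n * V.toReal)) = k * 2 ^ (n + 1) * (3 ^ (n + 1) * (w.2 / D ^ (n + 1))) := by
    rw [hH, show (6 : ℝ) = 2 * 3 by norm_num, mul_pow]
    field_simp
  rw [e]
  gcongr
  rw [← mul_div_assoc, div_le_div_iff₀ (by positivity) (by positivity)]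
  calc (w.2 : ℝ) * D ^ (n + 1) ≤ w.2 * (3 ^ (n + 1) * bdist w t ^ (n + 1)) := by gcongr
    _ = _ := by ring

lemma symKernel_pos (z w : HalfSpace n) : 0 < symKernel z w := by
  refine (lintegral_pos_iff_support
    ((measurable_pker_right z).mul (measurable_pker_right w))).2 ?_
  have h : Function.support (pker z * pker w) = Set.univ :=
    Function.support_eq_univ fun t =>
      (ENNReal.mul_pos (pker_pos z t).ne' (pker_pos w t).ne').ne'
  rw [h]
  exact isOpen_univ.measure_pos _ Set.univ_nonempty

lemma measurable_symKernel : Measurable (fun a : HalfSpace n × HalfSpace n =>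
    symKernel a.1 a.2) := by
  unfold symKernel
  refine Measurable.lintegral_prod_right'
    (f := fun b : (HalfSpace n × HalfSpace n) × EuclideanSpace ℝ (Fin n) =>
      pker b.1.1 b.2 * pker b.1.2 b.2) ?_
  exact (measurable_pker.comp (by fun_prop : Measurable
      fun b : (HalfSpace n × HalfSpace n) × EuclideanSpace ℝ (Fin n) => (b.1.1, b.2))).mul
    (measurable_pker.comp (by fun_prop : Measurable
      fun b : (HalfSpace n × HalfSpace n) × EuclideanSpace ℝ (Fin n) => (b.1.2, b.2)))

lemma measurable_symKernel_right (z : HalfSpace n) : Measurable (symKernel z) :=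
  Measurable.of_uncurry_left (f := symKernel) measurable_symKernel

lemma symKernel_le_of_height {b : ℝ≥0} (hb : ∀ z : HalfSpace n, ∫⁻ t, pker z t ≤ b)
    {δ : ℝ} (hδ : 0 < δ) {z : HalfSpace n} (hz : δ ≤ z.2) (w : HalfSpace n) :
    symKernel z w ≤ ENNReal.ofReal (kernelConst n * 2 ^ (n + 1) * (1 / δ ^ n)) * b := by
  calc symKernel z w
      ≤ ∫⁻ t, ENNReal.ofReal (kernelConst n * 2 ^ (n + 1) * (1 / δ ^ n)) * pker w t :=
        lintegral_mono fun t => mul_le_mul_left (pker_le_of_height hδ hz t) _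
    _ = ENNReal.ofReal (kernelConst n * 2 ^ (n + 1) * (1 / δ ^ n)) * ∫⁻ t, pker w t :=
        lintegral_const_mul' _ _ ENNReal.ofReal_ne_top
    _ ≤ _ := mul_le_mul_right (hb w) _

lemma symKernel_ne_top (z w : HalfSpace n) : symKernel z w ≠ ∞ := by
  obtain ⟨b, -, hb⟩ := exists_lintegral_pker_le n
  exact ((symKernel_le_of_height hb (height_pos z) le_rfl w).trans_lt
    (ENNReal.mul_lt_top ENNReal.ofReal_lt_top ENNReal.coe_lt_top)).ne

/-! ### Poisson integrals, balayage and symmetrized potentials -/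

lemma measurable_poisson (ν : Measure (EuclideanSpace ℝ (Fin n))) [SFinite ν] :
    Measurable (poisson ν) :=
  Measurable.lintegral_prod_right' measurable_pker

lemma measurable_balayage (μ : Measure (HalfSpace n)) [SFinite μ] : Measurable (balayage μ) :=
  Measurable.lintegral_prod_left' measurable_pker

lemma lintegral_poisson_eq (ν : Measure (EuclideanSpace ℝ (Fin n))) [SFinite ν]
    (μ : Measure (HalfSpace n)) [SFinite μ] :
    ∫⁻ z, poisson ν z ∂μ = ∫⁻ t, balayage μ t ∂ν :=
  lintegral_lintegral_swap measurable_pker.aemeasurable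

lemma symPotential_eq_lintegral_balayage (μ : Measure (HalfSpace n)) [SFinite μ]
    (z : HalfSpace n) : symPotential μ z = ∫⁻ t, pker z t * balayage μ t := by
  change ∫⁻ t, pker z t ∂(volume.withDensity (balayage μ)) = _
  rw [lintegral_withDensity_eq_lintegral_mul _ (measurable_balayage μ) (measurable_pker_right z)]
  exact lintegral_congr fun t => mul_comm _ _

lemma symPotential_eq_lintegral (μ : Measure (HalfSpace n)) [SFinite μ] (z : HalfSpace n) :
    symPotential μ z = ∫⁻ w, symKernel z w ∂μ := by
  rw [symPotential_eq_lintegral_balayage]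
  calc ∫⁻ t, pker z t * balayage μ t = ∫⁻ t, ∫⁻ w, pker z t * pker w t ∂μ :=
        lintegral_congr fun t => (lintegral_const_mul _ (measurable_pker_left t)).symm
    _ = ∫⁻ w, symKernel z w ∂μ := by
        refine lintegral_lintegral_swap (Measurable.aemeasurable ?_)
        exact ((measurable_pker_right z).comp measurable_fst).mul
          (measurable_pker.comp measurable_swap)

lemma measurable_symPotential (μ : Measure (HalfSpace n)) [SFinite μ] :
    Measurable (symPotential μ) := by
  rw [funext (symPotential_eq_lintegral μ)]
  exact Measurable.lintegral_prod_right' measurable_symKernel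

lemma lintegral_balayage_le {b : ℝ≥0} (hb : ∀ z : HalfSpace n, ∫⁻ t, pker z t ≤ b)
    (μ : Measure (HalfSpace n)) [SFinite μ] : ∫⁻ t, balayage μ t ≤ b * μ Set.univ := by
  rw [← lintegral_poisson_eq, ← lintegral_const]
  exact lintegral_mono hb

lemma symPotential_pos {μ : Measure (HalfSpace n)} [SFinite μ] (hμ : μ ≠ 0) (z : HalfSpace n) :
    0 < symPotential μ z := by
  rw [symPotential_eq_lintegral, lintegral_pos_iff_support
    (measurable_symKernel_right _)]
  have h : Function.support (symKernel z) = Set.univ :=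
    Function.support_eq_univ fun w => (symKernel_pos z w).ne'
  rw [h]
  exact Measure.measure_univ_pos.2 hμ

lemma symPotential_lt_top (μ : Measure (HalfSpace n)) [IsFiniteMeasure μ] (z : HalfSpace n) :
    symPotential μ z < ∞ := by
  obtain ⟨b, -, hb⟩ := exists_lintegral_pker_le n
  rw [symPotential_eq_lintegral]
  refine (lintegral_mono (symKernel_le_of_height hb (height_pos z) le_rfl)).trans_lt ?_
  rw [lintegral_const]
  exact ENNReal.mul_lt_top (ENNReal.mul_lt_top ENNReal.ofReal_lt_top ENNReal.coe_lt_top)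
    (measure_lt_top _ _)

lemma symPotential_mono {μ₁ μ₂ : Measure (HalfSpace n)} [SFinite μ₁] [SFinite μ₂] (h : μ₁ ≤ μ₂)
    (z : HalfSpace n) : symPotential μ₁ z ≤ symPotential μ₂ z := by
  rw [symPotential_eq_lintegral, symPotential_eq_lintegral]
  exact lintegral_mono' h le_rfl

lemma symPotential_powMeasure {q : ℝ} {σ : Measure (HalfSpace n)} [SFinite σ]
    {u : HalfSpace n → ℝ≥0∞} (hu : AEMeasurable u σ) (z : HalfSpace n) :
    symPotential (powMeasure q σ u) z = ∫⁻ w, u w ^ q * symKernel z w ∂σ := by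
  unfold powMeasure
  rw [symPotential_eq_lintegral]
  exact lintegral_withDensity_eq_lintegral_mul₀ (hu.pow_const q)
    (measurable_symKernel_right _).aemeasurable

/-! ### The maximum principle -/

/-- The constant `h` relates the Poisson kernel to the symmetrized kernel: `P(w, t) ≤ h K(z, w)`
whenever `z` is, up to a factor `2`, at least as close to `t` as `w`. -/
def IsMaxPrincipleConst (n : ℕ) (h : ℝ≥0) : Prop :=
  ∀ (z w : HalfSpace n) (t : EuclideanSpace ℝ (Fin n)),
    bdist z t ≤ 2 * bdist w t → pker w t ≤ h * symKernel z w

/-- The weak maximum principle: if `PP*μ ≤ l` on a set carrying `μ` and at a positive distance from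
the boundary, then `P*μ ≤ h l` everywhere on the boundary. -/
lemma balayage_le_of_symPotential_le {h : ℝ≥0} (hh : IsMaxPrincipleConst n h)
    {μ : Measure (HalfSpace n)} [SFinite μ] {E : Set (HalfSpace n)} (hμE : ∀ᵐ w ∂μ, w ∈ E)
    {δ : ℝ} (hδ : 0 < δ) (hE : ∀ w ∈ E, δ ≤ (w.2 : ℝ)) {l : ℝ≥0∞}
    (hl : ∀ z ∈ E, symPotential μ z ≤ l) (t : EuclideanSpace ℝ (Fin n)) :
    balayage μ t ≤ h * l := by
  rcases E.eq_empty_or_nonempty with rfl | hne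
  · have : μ = 0 := by simpa [ae_iff] using hμE
    simp [balayage, this]
  -- A point of `E` that minimizes the distance to `t` up to a factor `2`.
  obtain ⟨z, hzE, hz⟩ : ∃ z ∈ E, ∀ w ∈ E, bdist z t ≤ 2 * bdist w t := by
    set I := sInf ((fun w => bdist w t) '' E) with hI
    have hbdd : BddBelow ((fun w => bdist w t) '' E) :=
      ⟨0, by rintro _ ⟨w, -, rfl⟩; exact (bdist_pos w t).le⟩
    have hIpos : 0 < I := by
      refine hδ.trans_le (le_csInf (hne.image _) ?_)
      rintro _ ⟨w, hw, rfl⟩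
      exact (hE w hw).trans (height_le_bdist w t)
    obtain ⟨_, ⟨z, hzE, rfl⟩, hz⟩ :=
      exists_lt_of_csInf_lt (hne.image (fun w => bdist w t)) (show I < 2 * I by linarith)
    refine ⟨z, hzE, fun w hw => hz.le.trans ?_⟩
    have : I ≤ bdist w t := csInf_le hbdd ⟨w, hw, rfl⟩
    linarith
  calc balayage μ t = ∫⁻ w, pker w t ∂μ := rfl
    _ ≤ ∫⁻ w, h * symKernel z w ∂μ := by
        refine lintegral_mono_ae ?_
        filter_upwards [hμE] with w hw using hh z w t (hz w hw)
    _ = h * symPotential μ z := by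
        rw [lintegral_const_mul' _ _ ENNReal.coe_ne_top, symPotential_eq_lintegral]
    _ ≤ h * l := mul_le_mul_right (hl z hzE) _

/-! ### Finite equilibrium measures -/

open Matrix in
/-- Equilibrium measures on finite sets: a symmetric matrix `A` with nonnegative entries and
positive diagonal admits weights `m ≥ 0` with `A m ≥ 1` everywhere and `A m ≤ 1` where `m > 0`. They
are obtained by minimizing `m ⬝ A m / 2 - ∑ m` over a large box. -/
lemma exists_equilibrium {ι : Type*} [Fintype ι] [DecidableEq ι] (A : Matrix ι ι ℝ)
    (hsymm : A.IsSymm) (hnn : ∀ i j, 0 ≤ A i j) (hdiag : ∀ i, 0 < A i i) :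
    ∃ m : ι → ℝ, (∀ i, 0 ≤ m i) ∧ (∀ i, 1 ≤ (A *ᵥ m) i) ∧ ∀ i, 0 < m i → (A *ᵥ m) i ≤ 1 := by
  set f : (ι → ℝ) → ℝ := fun m => (m ⬝ᵥ A *ᵥ m) / 2 - ∑ i, m i with hf
  set R : ℝ := ∑ i, 1 / A i i + 1 with hR
  have hsum : ∀ i, 1 / A i i ≤ ∑ i, 1 / A i i := fun i =>
    Finset.single_le_sum (f := fun i => 1 / A i i) (fun j _ => (div_pos one_pos (hdiag j)).le)
      (Finset.mem_univ i)
  have hR0 : 0 < R := by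
    have : 0 ≤ ∑ i, 1 / A i i := Finset.sum_nonneg fun j _ => (div_pos one_pos (hdiag j)).le
    linarith
  have hcont : Continuous f := by
    simp only [hf, dotProduct, mulVec]
    fun_prop
  obtain ⟨m, hm, hmin⟩ := (isCompact_Icc (a := (0 : ι → ℝ)) (b := fun _ => R)).exists_isMinOn
    ⟨0, le_rfl, fun _ => hR0.le⟩ hcont.continuousOn
  have hm0 : ∀ i, 0 ≤ m i := hm.1
  have hmR : ∀ i, m i ≤ R := hm.2
  -- Perturbing one coordinate of the minimizer does not decrease the functional.
  have hpert : ∀ i (ε : ℝ), 0 ≤ m i + ε → m i + ε ≤ R →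
      0 ≤ ε * ((A *ᵥ m) i - 1) + ε ^ 2 * A i i / 2 := by
    intro i ε h0 h1
    have hmem : (m + Pi.single i ε : ι → ℝ) ∈ Set.Icc (0 : ι → ℝ) (fun _ => R) := by
      constructor
      · intro j
        by_cases hj : j = i
        · subst hj; simpa using h0
        · simpa [hj] using hm0 j
      · intro j
        by_cases hj : j = i
        · subst hj; simpa using h1
        · simpa [hj] using hmR j
    have h2 : f m ≤ f (m + Pi.single i ε) := hmin hmem
    have h3 : m ⬝ᵥ A *ᵥ Pi.single i ε = ε * (A *ᵥ m) i := by
      rw [dotProduct_mulVec, ← mulVec_transpose, hsymm.eq, dotProduct_single, mul_comm]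
    have h4 : (Pi.single i ε : ι → ℝ) ⬝ᵥ A *ᵥ Pi.single i ε = ε ^ 2 * A i i := by
      rw [single_dotProduct, mulVec_single]
      simp
      ring
    have h5 : ∑ j, (m + Pi.single i ε : ι → ℝ) j = ∑ j, m j + ε := by
      simp [Finset.sum_add_distrib]
    simp only [hf, mulVec_add, dotProduct_add, add_dotProduct, h3, h4, h5, single_dotProduct]
      at h2
    linarith
  have hle : ∀ i, 0 < m i → (A *ᵥ m) i ≤ 1 := by
    intro i hi
    by_contra! hcon
    have ha := hdiag i
    set g := (A *ᵥ m) i - 1 with hg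
    have hgpos : 0 < g := by linarith
    set ε := min (m i) (g / A i i) with hε
    have hεpos : 0 < ε := lt_min hi (by positivity)
    have h1 : ε ≤ m i := min_le_left _ _
    have h2 : ε * A i i ≤ g := (le_div_iff₀ ha).1 (min_le_right _ _)
    have := hpert i (-ε) (by linarith) (by linarith [hmR i])
    nlinarith
  refine ⟨m, hm0, fun i => ?_, hle⟩
  have ha := hdiag i
  -- The box is so large that the minimizer does not touch its upper faces.
  have hlt : m i < R := by
    rcases (hm0 i).eq_or_lt with h | h
    · rw [← h]; exact hR0
    · have h1 : A i i * m i ≤ (A *ᵥ m) i :=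
        Finset.single_le_sum (f := fun j => A i j * m j)
          (fun j _ => mul_nonneg (hnn i j) (hm0 j)) (Finset.mem_univ i)
      have h2 : m i ≤ 1 / A i i := by
        rw [le_div_iff₀ ha]; linarith [hle i h]
      linarith [hsum i]
  by_contra! hcon
  set g := 1 - (A *ᵥ m) i with hg
  have hgpos : 0 < g := by linarith
  set ε := min (R - m i) (g / A i i) with hε
  have hεpos : 0 < ε := lt_min (by linarith) (by positivity)
  have h1 : ε ≤ R - m i := min_le_left _ _
  have h2 : ε * A i i ≤ g := (le_div_iff₀ ha).1 (min_le_right _ _)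
  have h3 := hpert i ε (by linarith [hm0 i]) (by linarith)
  have h4 : (A *ᵥ m) i - 1 = -g := by rw [hg]; ring
  rw [h4] at h3
  nlinarith

/-- Equilibrium weights for the symmetrized kernel on a finite family of points. The maximum
principle bounds the balayage of the associated discrete measure. -/
lemma exists_equilibrium_symKernel {h : ℝ≥0} (hh : IsMaxPrincipleConst n h) {ι : Type*}
    [Fintype ι] (z : ι → HalfSpace n) :
    ∃ m : ι → ℝ≥0∞, (∀ i, 1 ≤ ∑ j, m j * symKernel (z i) (z j)) ∧
      ∀ t, ∑ j, m j * pker (z j) t ≤ h := by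
  classical
  obtain ⟨m, hm0, hm1, hm2⟩ := exists_equilibrium
    (Matrix.of fun i j => (symKernel (z i) (z j)).toReal)
    (by ext i j; simp [symKernel_comm])
    (fun i j => ENNReal.toReal_nonneg)
    (fun i => ENNReal.toReal_pos (symKernel_pos _ _).ne' (symKernel_ne_top _ _))
  have hconv : ∀ i, ∑ j, ENNReal.ofReal (m j) * symKernel (z i) (z j) =
      ENNReal.ofReal (Matrix.mulVec
        (Matrix.of fun i j => (symKernel (z i) (z j)).toReal) m i) := by
    intro i
    simp only [Matrix.mulVec, dotProduct, Matrix.of_apply]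
    rw [ENNReal.ofReal_sum_of_nonneg
      (fun j _ => mul_nonneg ENNReal.toReal_nonneg (hm0 j))]
    refine Finset.sum_congr rfl fun j _ => ?_
    rw [ENNReal.ofReal_mul ENNReal.toReal_nonneg, ENNReal.ofReal_toReal (symKernel_ne_top _ _),
      mul_comm]
  refine ⟨fun i => ENNReal.ofReal (m i), fun i => ?_, fun t => ?_⟩
  · rw [hconv, ← ENNReal.ofReal_one]
    exact ENNReal.ofReal_le_ofReal (hm1 i)
  · set μ : Measure (HalfSpace n) := ∑ j, ENNReal.ofReal (m j) • Measure.dirac (z j) with hμ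
    have hlint : ∀ f : HalfSpace n → ℝ≥0∞, Measurable f →
        ∫⁻ w, f w ∂μ = ∑ j, ENNReal.ofReal (m j) * f (z j) := by
      intro f hf
      rw [hμ, lintegral_finsetSum_measure]
      refine Finset.sum_congr rfl fun j _ => ?_
      rw [lintegral_smul_measure, lintegral_dirac' _ hf, smul_eq_mul]
    have hfin : IsFiniteMeasure μ := by
      refine ⟨?_⟩
      rw [← lintegral_one, hlint _ measurable_const]
      simp
    set s : Finset ι := Finset.univ.filter fun i => 0 < m i with hs
    obtain ⟨δ, hδ, hδs⟩ : ∃ δ : ℝ, 0 < δ ∧ ∀ i ∈ s, δ ≤ ((z i).2 : ℝ) := by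
      rcases s.eq_empty_or_nonempty with h0 | h0
      · exact ⟨1, one_pos, by simp [h0]⟩
      · obtain ⟨i, -, hi⟩ := s.exists_min_image (fun i => ((z i).2 : ℝ)) h0
        exact ⟨_, height_pos (z i), hi⟩
    have hae : ∀ᵐ w ∂μ, w ∈ z '' (s : Set ι) := by
      have hms : MeasurableSet (z '' (s : Set ι))ᶜ :=
        (s.finite_toSet.image z).measurableSet.compl
      rw [ae_iff]
      change μ (z '' (s : Set ι))ᶜ = 0
      rw [← lintegral_indicator_one hms, hlint _ (measurable_one.indicator hms)]
      refine Finset.sum_eq_zero fun j _ => ?_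
      by_cases hj : 0 < m j
      · have : z j ∈ z '' (s : Set ι) := ⟨j, by simp [hs, hj], rfl⟩
        simp [Set.indicator, this]
      · rw [ENNReal.ofReal_of_nonpos (not_lt.1 hj), zero_mul]
    have key := balayage_le_of_symPotential_le hh hae hδ
      (by rintro _ ⟨i, hi, rfl⟩; exact hδs i hi) (l := 1)
      (by
        rintro _ ⟨i, hi, rfl⟩
        rw [symPotential_eq_lintegral, hlint _ (measurable_symKernel_right _),
          hconv, ← ENNReal.ofReal_one]
        exact ENNReal.ofReal_le_ofReal (hm2 i (by simpa [hs] using hi))) t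
    rw [mul_one] at key
    rw [← hlint (fun w => pker w t) (measurable_pker_left t)]
    exact key

/-! ### The weak-type inequality -/

lemma symKernel_harnack (c : HalfSpace n) {z w : HalfSpace n} (hz : dist z c < c.2 / 8)
    (hw : dist w c < c.2 / 8) (x : HalfSpace n) :
    symKernel x z ≤ ENNReal.ofReal (2 ^ (2 * n + 3)) * symKernel x w := by
  unfold symKernel
  rw [← lintegral_const_mul' _ _ ENNReal.ofReal_ne_top]
  refine lintegral_mono fun t => ?_
  calc pker x t * pker z t ≤ pker x t * (ENNReal.ofReal (2 ^ (2 * n + 3)) * pker w t) :=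
        mul_le_mul_right (pker_harnack c hz hw t) _
    _ = _ := by ring

/-- The discrete form of the weak-type inequality. On finitely many disjoint Whitney pieces the
measure `μ` may be moved to single points, and is then tested against equilibrium weights. -/
lemma weakType_finite {h : ℝ≥0} (hh : IsMaxPrincipleConst n h) (μ : Measure (HalfSpace n))
    [SFinite μ] (ν : Measure (EuclideanSpace ℝ (Fin n))) (l : ℝ≥0∞) {ι : Type*} [Fintype ι]
    (F : ι → Set (HalfSpace n)) (hF : ∀ i, MeasurableSet (F i))
    (hdisj : Pairwise (Function.onFun Disjoint F)) (z c : ι → HalfSpace n)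
    (hz : ∀ i, z i ∈ F i) (hFc : ∀ i, ∀ w ∈ F i, dist w (c i) < (c i).2 / 8)
    (hl : ∀ i, l * symPotential μ (z i) ≤ poisson ν (z i)) :
    l * ∑ i, μ (F i) ≤ ENNReal.ofReal (2 ^ (2 * n + 3)) * h * ν Set.univ := by
  obtain ⟨m, hm1, hm2⟩ := exists_equilibrium_symKernel hh z
  set H : ℝ≥0∞ := ENNReal.ofReal (2 ^ (2 * n + 3)) with hH
  have hpiece : ∀ i, ∑ j, μ (F j) * symKernel (z i) (z j) ≤ H * symPotential μ (z i) := by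
    intro i
    calc ∑ j, μ (F j) * symKernel (z i) (z j)
        ≤ ∑ j, ∫⁻ w in F j, H * symKernel (z i) w ∂μ := by
          refine Finset.sum_le_sum fun j _ => ?_
          rw [mul_comm, ← setLIntegral_const]
          exact setLIntegral_mono_ae' (hF j) (ae_of_all _ fun w hw =>
            symKernel_harnack (c j) (hFc j _ (hz j)) (hFc j w hw) (z i))
      _ = ∫⁻ w in ⋃ j, F j, H * symKernel (z i) w ∂μ := by
          rw [lintegral_iUnion hF hdisj, tsum_fintype]
      _ ≤ ∫⁻ w, H * symKernel (z i) w ∂μ := setLIntegral_le_lintegral _ _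
      _ = H * symPotential μ (z i) := by
          rw [lintegral_const_mul' _ _ ENNReal.ofReal_ne_top, symPotential_eq_lintegral]
  calc l * ∑ j, μ (F j)
      ≤ l * ∑ j, μ (F j) * ∑ i, m i * symKernel (z j) (z i) := by
        gcongr with j
        exact le_mul_of_one_le_right' (hm1 j)
    _ = ∑ i, m i * (l * ∑ j, μ (F j) * symKernel (z i) (z j)) := by
        simp only [Finset.mul_sum]
        rw [Finset.sum_comm]
        refine Finset.sum_congr rfl fun i _ => Finset.sum_congr rfl fun j _ => ?_
        rw [symKernel_comm (z j)]
        ring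
    _ ≤ ∑ i, m i * (H * poisson ν (z i)) := by
        refine Finset.sum_le_sum fun i _ => mul_le_mul_right ?_ _
        calc l * ∑ j, μ (F j) * symKernel (z i) (z j) ≤ l * (H * symPotential μ (z i)) := by
              gcongr; exact hpiece i
          _ = H * (l * symPotential μ (z i)) := by ring
          _ ≤ _ := by gcongr; exact hl i
    _ = H * ∫⁻ t, ∑ i, m i * pker (z i) t ∂ν := by
        rw [lintegral_finsetSum _ fun i _ => (measurable_pker_right (z i)).const_mul _,
          Finset.mul_sum]
        refine Finset.sum_congr rfl fun i _ => ?_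
        rw [lintegral_const_mul _ (measurable_pker_right (z i))]
        change m i * (H * poisson ν (z i)) = H * (m i * poisson ν (z i))
        ring
    _ ≤ H * ∫⁻ _, h ∂ν := by gcongr with t; exact hm2 t
    _ = _ := by rw [lintegral_const, mul_assoc]

/-- The weak-type `(1, 1)` inequality for the quotient `Pν / PP*μ` with respect to `μ`. -/
lemma weakType {h : ℝ≥0} (hh : IsMaxPrincipleConst n h) (μ : Measure (HalfSpace n))
    [SFinite μ] (ν : Measure (EuclideanSpace ℝ (Fin n))) [SFinite ν] (l : ℝ≥0∞) :
    l * μ {z | l * symPotential μ z ≤ poisson ν z} ≤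
      ENNReal.ofReal (2 ^ (2 * n + 3)) * h * ν Set.univ := by
  classical
  set E : Set (HalfSpace n) := {z | l * symPotential μ z ≤ poisson ν z} with hE
  have hEm : MeasurableSet E :=
    measurableSet_le ((measurable_symPotential μ).const_mul l) (measurable_poisson ν)
  have : Nonempty (HalfSpace n) := ⟨(0, ⟨1, Set.mem_Ioi.2 one_pos⟩)⟩
  set c : ℕ → HalfSpace n := TopologicalSpace.denseSeq (HalfSpace n) with hc
  set B : ℕ → Set (HalfSpace n) := fun k => Metric.ball (c k) ((c k).2 / 8) with hB
  have hBm : ∀ k, MeasurableSet (B k) := fun k => measurableSet_ball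
  have hBU : ⋃ k, B k = Set.univ := by
    refine Set.eq_univ_of_forall fun z => Set.mem_iUnion.2 ?_
    have hz := height_pos z
    obtain ⟨k, hk⟩ := (TopologicalSpace.denseRange_denseSeq (HalfSpace n)).exists_dist_lt z
      (show (0 : ℝ) < z.2 / 16 by positivity)
    refine ⟨k, ?_⟩
    have h1 : |(z.2 : ℝ) - (c k).2| < z.2 / 16 := (le_max_right _ _).trans_lt hk
    rw [abs_lt] at h1
    rw [hB, Metric.mem_ball]
    refine hk.trans ?_
    linarith
  set D : ℕ → Set (HalfSpace n) := disjointed B with hD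
  have hDm : ∀ k, MeasurableSet (D k) := fun k => MeasurableSet.disjointed hBm k
  have hDdisj : Pairwise (Function.onFun Disjoint D) := disjoint_disjointed B
  have hEU : E = ⋃ k, E ∩ D k := by
    rw [← Set.inter_iUnion, hD, iUnion_disjointed, hBU, Set.inter_univ]
  have hμE : μ E = ∑' k, μ (E ∩ D k) := by
    conv_lhs => rw [hEU]
    exact measure_iUnion
      (fun i j hij => (hDdisj hij).mono Set.inter_subset_right Set.inter_subset_right)
      (fun k => hEm.inter (hDm k))
  rw [hμE, ← ENNReal.tsum_mul_left]
  rw [ENNReal.tsum_eq_iSup_sum]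
  refine iSup_le fun s => ?_
  set s' := s.filter fun k => (E ∩ D k).Nonempty with hs'
  have hsum : ∑ k ∈ s, l * μ (E ∩ D k) = l * ∑ k : s', μ (E ∩ D k) := by
    rw [← Finset.mul_sum, Finset.sum_coe_sort s' (fun k => μ (E ∩ D k)), hs',
      Finset.sum_filter_of_ne]
    intro k _ hk
    exact nonempty_of_measure_ne_zero hk
  rw [hsum]
  have hne : ∀ k : s', (E ∩ D k).Nonempty := fun k => (Finset.mem_filter.1 k.2).2
  choose z hz using hne
  refine weakType_finite hh μ ν l (fun k : s' => E ∩ D k) (fun k => hEm.inter (hDm k))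
    (fun i j hij => (hDdisj (fun h => hij (Subtype.ext h))).mono Set.inter_subset_right
      Set.inter_subset_right) z (fun k => c k) hz
    (fun k w hw => disjointed_subset B k hw.2) (fun k => (hz k).1)

/-! ### Exhaustion of the half-space -/

/-- An exhaustion of the half-space by sets of finite measure at a positive distance from the
boundary. -/
def exhaustion (σ : Measure (HalfSpace n)) [SigmaFinite σ] (m : ℕ) : Set (HalfSpace n) :=
  spanningSets σ m ∩ {z | 1 / ((m : ℝ) + 1) ≤ (z.2 : ℝ)}

section Exhaustion

variable (σ : Measure (HalfSpace n)) [SigmaFinite σ]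

lemma measurableSet_exhaustion (m : ℕ) : MeasurableSet (exhaustion σ m) :=
  (measurableSet_spanningSets σ m).inter (measurableSet_le (by fun_prop) (by fun_prop))

lemma monotone_exhaustion : Monotone (exhaustion σ) := by
  intro i j hij
  refine Set.inter_subset_inter (monotone_spanningSets σ hij) fun z hz => ?_
  have h : 1 / ((j : ℝ) + 1) ≤ 1 / ((i : ℝ) + 1) := by gcongr
  exact h.trans hz

lemma iUnion_exhaustion : ⋃ m, exhaustion σ m = Set.univ := by
  refine Set.eq_univ_of_forall fun z => ?_
  obtain ⟨i, hi⟩ := Set.mem_iUnion.1 ((iUnion_spanningSets σ).symm ▸ Set.mem_univ z)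
  obtain ⟨j, hj⟩ := exists_nat_one_div_lt (height_pos z)
  refine Set.mem_iUnion.2 ⟨max i j, monotone_spanningSets σ (le_max_left i j) hi, ?_⟩
  refine le_trans (one_div_le_one_div_of_le (by positivity) ?_) hj.le
  gcongr
  exact le_max_right i j

instance isFiniteMeasure_restrict_exhaustion (m : ℕ) :
    IsFiniteMeasure (σ.restrict (exhaustion σ m)) := by
  refine ⟨?_⟩
  rw [Measure.restrict_apply_univ]
  exact (measure_mono Set.inter_subset_left).trans_lt (measure_spanningSets_lt_top σ m)

lemma ae_height_exhaustion (m : ℕ) :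
    ∀ᵐ w ∂(σ.restrict (exhaustion σ m)), 1 / ((m : ℝ) + 1) ≤ (w.2 : ℝ) :=
  (ae_restrict_mem (measurableSet_exhaustion σ m)).mono fun _ hw => hw.2

lemma tendsto_symPotential_exhaustion (z : HalfSpace n) :
    Tendsto (fun m => symPotential (σ.restrict (exhaustion σ m)) z) atTop
      (𝓝 (symPotential σ z)) := by
  have h := tendsto_measure_iUnion_atTop (μ := σ.withDensity (symKernel z))
    (monotone_exhaustion σ)
  rw [iUnion_exhaustion, withDensity_apply _ MeasurableSet.univ, Measure.restrict_univ,
    ← symPotential_eq_lintegral] at h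
  refine h.congr fun m => ?_
  rw [Function.comp_apply, withDensity_apply _ (measurableSet_exhaustion σ m),
    symPotential_eq_lintegral]

end Exhaustion

/-! ### Powers of potentials -/

/-- The pointwise inequality `(PP*μ)^{1+a} ≤ 2 (2bh)^a PP*((PP*μ)^a μ)` for a finite measure living
at a positive distance from the boundary. By the maximum principle, the part of `μ` where `PP*μ` is
small contributes at most half of the potential at `z`. -/
lemma rpow_symPotential_le_of_isFiniteMeasure {b h : ℝ≥0}
    (hb0 : 0 < b) (hb : ∀ z : HalfSpace n, ∫⁻ t, pker z t ≤ b)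
    (hh0 : 0 < h) (hh : IsMaxPrincipleConst n h) {a : ℝ} (ha : 0 ≤ a)
    (μ : Measure (HalfSpace n)) [IsFiniteMeasure μ] {δ : ℝ} (hδ : 0 < δ)
    (hμδ : ∀ᵐ w ∂μ, δ ≤ (w.2 : ℝ)) (z : HalfSpace n) :
    symPotential μ z ^ (1 + a) ≤
      ((2 * (2 * b * h) ^ a : ℝ≥0) : ℝ≥0∞) * ∫⁻ w, symPotential μ w ^ a * symKernel z w ∂μ := by
  set M := symPotential μ z with hM
  have hMtop : M ≠ ∞ := (symPotential_lt_top μ z).ne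
  have hk0 : (2 * b * h : ℝ≥0) ≠ 0 := by positivity
  set l : ℝ≥0∞ := M / ((2 * b * h : ℝ≥0) : ℝ≥0∞) with hl
  have hlM : ((2 * b * h : ℝ≥0) : ℝ≥0∞) * l = M :=
    ENNReal.mul_div_cancel (by exact_mod_cast hk0) ENNReal.coe_ne_top
  set E : Set (HalfSpace n) := {w | δ ≤ (w.2 : ℝ)} ∩ {w | symPotential μ w ≤ l} with hE
  have hEm : MeasurableSet E :=
    (measurableSet_le (by fun_prop) (by fun_prop)).inter
      (measurableSet_le (measurable_symPotential μ) measurable_const)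
  have hbal := balayage_le_of_symPotential_le hh (μ := μ.restrict E) (ae_restrict_mem hEm) hδ
    (fun w hw => hw.1)
    (fun w hw => (symPotential_mono Measure.restrict_le_self w).trans hw.2)
  have hsmall : ∫⁻ w in E, symKernel z w ∂μ ≤ b * (h * l) := by
    rw [← symPotential_eq_lintegral, symPotential_eq_lintegral_balayage]
    calc ∫⁻ t, pker z t * balayage (μ.restrict E) t ≤ ∫⁻ t, pker z t * (h * l) :=
          lintegral_mono fun t => mul_le_mul_right (hbal t) _
      _ = (∫⁻ t, pker z t) * (h * l) := lintegral_mul_const _ (measurable_pker_right z)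
      _ ≤ _ := mul_le_mul_left (hb z) _
  have hdouble : M = b * (h * l) + b * (h * l) := by
    rw [← hlM]; push_cast; ring
  have hsplit : M = ∫⁻ w in E, symKernel z w ∂μ + ∫⁻ w in Eᶜ, symKernel z w ∂μ := by
    rw [lintegral_add_compl _ hEm, ← symPotential_eq_lintegral]
  have hlarge : b * (h * l) ≤ ∫⁻ w in Eᶜ, symKernel z w ∂μ := by
    have hfin : b * (h * l) ≠ ∞ := ne_top_of_le_ne_top hMtop (hdouble ▸ le_self_add)
    refine (ENNReal.add_le_add_iff_left hfin).1 ?_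
    rw [← hdouble, hsplit]
    exact add_le_add_left hsmall _
  have hlow : l ^ a * (b * (h * l)) ≤ ∫⁻ w, symPotential μ w ^ a * symKernel z w ∂μ := by
    calc l ^ a * (b * (h * l)) ≤ l ^ a * ∫⁻ w in Eᶜ, symKernel z w ∂μ :=
          mul_le_mul_right hlarge _
      _ = ∫⁻ w in Eᶜ, l ^ a * symKernel z w ∂μ :=
          (lintegral_const_mul _ (measurable_symKernel_right z)).symm
      _ ≤ ∫⁻ w in Eᶜ, symPotential μ w ^ a * symKernel z w ∂μ := by
          refine lintegral_mono_ae ?_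
          filter_upwards [ae_restrict_mem hEm.compl, ae_restrict_of_ae hμδ] with w hw hwδ
          have hlw : l < symPotential μ w := by
            by_contra hcon
            exact hw ⟨hwδ, not_lt.1 hcon⟩
          gcongr
      _ ≤ _ := setLIntegral_le_lintegral _ _
  calc M ^ (1 + a) = M * M ^ a := by
        rw [ENNReal.rpow_add_of_nonneg _ _ zero_le_one ha, ENNReal.rpow_one]
    _ = (b * (h * l) + b * (h * l)) * (((2 * b * h : ℝ≥0) : ℝ≥0∞) * l) ^ a := by
        rw [hlM, ← hdouble]
    _ = ((2 * (2 * b * h) ^ a : ℝ≥0) : ℝ≥0∞) * (l ^ a * (b * (h * l))) := by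
        rw [ENNReal.mul_rpow_of_nonneg _ _ ha, ENNReal.coe_mul 2,
          ENNReal.coe_rpow_of_nonneg _ ha]
        push_cast
        ring
    _ ≤ _ := mul_le_mul_right hlow _

/-- The pointwise inequality `(PP*σ)^{1+a} ≤ 2 (2bh)^a PP*((PP*σ)^a σ)`. -/
lemma rpow_symPotential_le {b h : ℝ≥0}
    (hb0 : 0 < b) (hb : ∀ z : HalfSpace n, ∫⁻ t, pker z t ≤ b)
    (hh0 : 0 < h) (hh : IsMaxPrincipleConst n h) {a : ℝ} (ha : 0 ≤ a)
    (σ : Measure (HalfSpace n)) [SigmaFinite σ] (z : HalfSpace n) :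
    symPotential σ z ^ (1 + a) ≤
      ((2 * (2 * b * h) ^ a : ℝ≥0) : ℝ≥0∞) * ∫⁻ w, symPotential σ w ^ a * symKernel z w ∂σ := by
  refine le_of_tendsto' ((ENNReal.continuous_rpow_const.tendsto _).comp
    (tendsto_symPotential_exhaustion σ z)) fun m => ?_
  refine (rpow_symPotential_le_of_isFiniteMeasure hb0 hb hh0 hh ha _ (by positivity)
    (ae_height_exhaustion σ m) z).trans (mul_le_mul_right ?_ _)
  refine lintegral_mono' Measure.restrict_le_self fun w => ?_
  gcongr
  exact symPotential_mono Measure.restrict_le_self w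

/-- With `c` small, `c (PP*σ)^{1/(1-q)}` is a subsolution of `u = PP*(u^q σ)`. -/
lemma exists_const_subsolution (n : ℕ) {q : ℝ} (hq0 : 0 < q) (hq1 : q < 1) :
    ∃ c₁ : ℝ≥0, 0 < c₁ ∧ ∀ c : ℝ≥0, c ≤ c₁ →
      ∀ (σ : Measure (HalfSpace n)) [SigmaFinite σ] (z : HalfSpace n),
        (c : ℝ≥0∞) * symPotential σ z ^ (1 / (1 - q)) ≤
          symPotential (powMeasure q σ fun w => c * symPotential σ w ^ (1 / (1 - q))) z := by
  obtain ⟨b, hb0, hb⟩ := exists_lintegral_pker_le n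
  obtain ⟨h, hh0, hh⟩ := exists_pker_le_symKernel n
  have h1q : 0 < 1 - q := by linarith
  set a : ℝ := q / (1 - q) with ha
  have ha0 : 0 ≤ a := by positivity
  have has : 1 / (1 - q) = 1 + a := by rw [ha]; field_simp; ring
  have hsq : 1 / (1 - q) * q = a := by rw [ha]; field_simp
  set C : ℝ≥0 := 2 * (2 * b * h) ^ a with hC
  have hC0 : 0 < C := by positivity
  refine ⟨(C⁻¹) ^ (1 / (1 - q)), by positivity, fun c hc σ _ z => ?_⟩
  -- The smallness of `c` amounts to `c C ≤ c ^ q`.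
  have hcC : c * C ≤ c ^ q := by
    have h1 : c ^ (1 - q) ≤ C⁻¹ := by
      rw [one_div] at hc
      exact (NNReal.le_rpow_inv_iff h1q).1 hc
    rcases eq_or_ne c 0 with rfl | hc0
    · simp
    have h2 : c = c ^ q * c ^ (1 - q) := by
      rw [← NNReal.rpow_add hc0]; simp
    calc c * C = c ^ q * c ^ (1 - q) * C := by rw [← h2]
      _ = c ^ q * (c ^ (1 - q) * C) := mul_assoc _ _ _
      _ ≤ c ^ q * (C⁻¹ * C) := by gcongr
      _ = c ^ q := by rw [inv_mul_cancel₀ hC0.ne', mul_one]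
  rw [symPotential_powMeasure
    (((measurable_symPotential σ).pow_const _).const_mul _).aemeasurable]
  calc (c : ℝ≥0∞) * symPotential σ z ^ (1 / (1 - q))
      ≤ c * (C * ∫⁻ w, symPotential σ w ^ a * symKernel z w ∂σ) := by
        rw [has]
        exact mul_le_mul_right (rpow_symPotential_le hb0 hb hh0 hh ha0 σ z) _
    _ = ((c * C : ℝ≥0) : ℝ≥0∞) * ∫⁻ w, symPotential σ w ^ a * symKernel z w ∂σ := by
        push_cast; ring
    _ ≤ ((c ^ q : ℝ≥0) : ℝ≥0∞) * ∫⁻ w, symPotential σ w ^ a * symKernel z w ∂σ :=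
        mul_le_mul_left (ENNReal.coe_le_coe.2 hcC) _
    _ = ∫⁻ w, ((c : ℝ≥0∞) * symPotential σ w ^ (1 / (1 - q))) ^ q * symKernel z w ∂σ := by
        rw [← lintegral_const_mul' _ _ ENNReal.coe_ne_top]
        refine lintegral_congr fun w => ?_
        rw [ENNReal.mul_rpow_of_nonneg _ _ hq0.le, ← ENNReal.rpow_mul, hsq,
          ENNReal.coe_rpow_of_nonneg _ hq0.le, mul_assoc]

/-! ### Consequences of the Carleson inequality -/

lemma eLpNorm_ofReal_le_iff {q : ℝ} (hq0 : 0 < q) (σ : Measure (HalfSpace n))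
    (f : HalfSpace n → ℝ≥0∞) (A : ℝ≥0∞) :
    eLpNorm f (ENNReal.ofReal q) σ ≤ A ↔ ∫⁻ z, f z ^ q ∂σ ≤ A ^ q := by
  rw [eLpNorm_eq_lintegral_rpow_enorm_toReal (by simpa using hq0) ENNReal.ofReal_ne_top,
    ENNReal.toReal_ofReal hq0.le, one_div, ENNReal.rpow_inv_le_iff hq0]
  simp

lemma memLp_ofReal_iff {q : ℝ} (hq0 : 0 < q) (σ : Measure (HalfSpace n))
    (f : HalfSpace n → ℝ≥0∞) :
    MemLp f (ENNReal.ofReal q) σ ↔ AEMeasurable f σ ∧ ∫⁻ z, f z ^ q ∂σ < ∞ := by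
  unfold MemLp
  rw [eLpNorm_lt_top_iff_lintegral_rpow_enorm_lt_top (by simpa using hq0) ENNReal.ofReal_ne_top,
    ENNReal.toReal_ofReal hq0.le, aestronglyMeasurable_iff_aemeasurable]
  simp

lemma powMeasure_univ (q : ℝ) (σ : Measure (HalfSpace n)) (u : HalfSpace n → ℝ≥0∞) :
    powMeasure q σ u Set.univ = ∫⁻ z, u z ^ q ∂σ := by
  rw [powMeasure, withDensity_apply _ MeasurableSet.univ, Measure.restrict_univ]

/-- The integrated form of the `(1, q)`-Carleson inequality with constant `κ`. -/
def CarlesonBound (q : ℝ) (σ : Measure (HalfSpace n)) (κ : ℝ≥0) : Prop :=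
  ∀ (ν : Measure (EuclideanSpace ℝ (Fin n))) [IsLocallyFiniteMeasure ν],
    ∫⁻ z, poisson ν z ^ q ∂σ ≤ (κ * ν Set.univ) ^ q

lemma carlesonInequality_iff {q : ℝ} (hq0 : 0 < q) (σ : Measure (HalfSpace n)) :
    CarlesonInequality q σ ↔ ∃ κ : ℝ≥0, 0 < κ ∧ CarlesonBound q σ κ := by
  simp only [CarlesonInequality, CarlesonBound, eLpNorm_ofReal_le_iff hq0]

lemma CarlesonBound.mono {q : ℝ} {σ σ' : Measure (HalfSpace n)} {κ : ℝ≥0}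
    (hκ : CarlesonBound q σ κ) (hσ : σ' ≤ σ) : CarlesonBound q σ' κ :=
  fun ν _ => (lintegral_mono' hσ le_rfl).trans (hκ ν)

lemma CarlesonBound.lintegral_symPotential_le {q : ℝ} {σ : Measure (HalfSpace n)}
    {κ b : ℝ≥0} (hκ : CarlesonBound q σ κ) (hq0 : 0 < q)
    (hb : ∀ z : HalfSpace n, ∫⁻ t, pker z t ≤ b) (μ : Measure (HalfSpace n))
    [IsFiniteMeasure μ] :
    ∫⁻ z, symPotential μ z ^ q ∂σ ≤ (((κ * b : ℝ≥0) : ℝ≥0∞) * μ Set.univ) ^ q := by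
  have hmass : (volume.withDensity (balayage μ)) Set.univ ≤ b * μ Set.univ := by
    rw [withDensity_apply _ MeasurableSet.univ, Measure.restrict_univ]
    exact lintegral_balayage_le hb μ
  have hfin : IsFiniteMeasure (volume.withDensity (balayage μ)) :=
    ⟨hmass.trans_lt (ENNReal.mul_lt_top ENNReal.coe_lt_top (measure_lt_top _ _))⟩
  refine (hκ (volume.withDensity (balayage μ))).trans ?_
  rw [ENNReal.coe_mul, mul_assoc]
  gcongr

/-- A priori bound: a subsolution of `u = PP*(u^q σ)` whose `L^q` norm is finite has an `L^q` norm
controlled by the Carleson constant alone. -/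
lemma CarlesonBound.lintegral_rpow_le_of_subsolution {q : ℝ} {σ : Measure (HalfSpace n)}
    {κ b : ℝ≥0} (hκ : CarlesonBound q σ κ) (hq0 : 0 < q) (hq1 : q < 1)
    (hb : ∀ z : HalfSpace n, ∫⁻ t, pker z t ≤ b) {v : HalfSpace n → ℝ≥0∞}
    (hv : ∀ z, v z ≤ symPotential (powMeasure q σ v) z) (hfin : ∫⁻ z, v z ^ q ∂σ ≠ ∞) :
    ∫⁻ z, v z ^ q ∂σ ≤ ((κ * b : ℝ≥0) : ℝ≥0∞) ^ (q / (1 - q)) := by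
  have h1q : 0 < 1 - q := by linarith
  have hfm : IsFiniteMeasure (powMeasure q σ v) := isFiniteMeasure_withDensity hfin
  set A := ∫⁻ z, v z ^ q ∂σ with hA
  have hstep : A ≤ (((κ * b : ℝ≥0) : ℝ≥0∞) * A) ^ q := by
    calc A ≤ ∫⁻ z, symPotential (powMeasure q σ v) z ^ q ∂σ :=
          lintegral_mono fun z => ENNReal.rpow_le_rpow (hv z) hq0.le
      _ ≤ _ := by
          rw [hA, ← powMeasure_univ q σ v]
          exact hκ.lintegral_symPotential_le hq0 hb (powMeasure q σ v)
  rcases eq_or_ne A 0 with h0 | h0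
  · rw [h0]; exact zero_le
  have h1 : A ^ (1 - q) ≤ ((κ * b : ℝ≥0) : ℝ≥0∞) ^ q := by
    rw [ENNReal.mul_rpow_of_nonneg _ _ hq0.le] at hstep
    have hAq0 : A ^ q ≠ 0 := by simp [h0, hfin]
    have hAqt : A ^ q ≠ ∞ := (ENNReal.rpow_lt_top_of_nonneg hq0.le hfin).ne
    refine (ENNReal.mul_le_mul_iff_right hAq0 hAqt).1 ?_
    rw [← ENNReal.rpow_add _ _ h0 hfin, mul_comm]
    simpa using hstep
  calc A = (A ^ (1 - q)) ^ (1 / (1 - q)) := by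
        rw [← ENNReal.rpow_mul, mul_one_div_cancel h1q.ne', ENNReal.rpow_one]
    _ ≤ (((κ * b : ℝ≥0) : ℝ≥0∞) ^ q) ^ (1 / (1 - q)) :=
        ENNReal.rpow_le_rpow h1 (by positivity)
    _ = _ := by rw [← ENNReal.rpow_mul, mul_one_div]

/-- Under the Carleson inequality the subsolutions `c (PP*σ)^{1/(1-q)}` belong to `L^q(σ)`. -/
lemma CarlesonBound.lintegral_symPotential_rpow_lt_top {q : ℝ} {σ : Measure (HalfSpace n)}
    [SigmaFinite σ] {κ : ℝ≥0} (hκ : CarlesonBound q σ κ) (hq0 : 0 < q) (hq1 : q < 1) {c : ℝ≥0}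
    (hsub : ∀ (σ' : Measure (HalfSpace n)) [SigmaFinite σ'] (z : HalfSpace n),
        (c : ℝ≥0∞) * symPotential σ' z ^ (1 / (1 - q)) ≤
          symPotential (powMeasure q σ' fun w => c * symPotential σ' w ^ (1 / (1 - q))) z) :
    ∫⁻ z, (c * symPotential σ z ^ (1 / (1 - q))) ^ q ∂σ < ∞ := by
  obtain ⟨b, -, hb⟩ := exists_lintegral_pker_le n
  have h1q : 0 < 1 - q := by linarith
  set S := exhaustion σ with hS
  set v : ℕ → HalfSpace n → ℝ≥0∞ := fun m z =>
    (c * symPotential (σ.restrict (S m)) z ^ (1 / (1 - q))) ^ q with hv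
  have hvm : ∀ m, Measurable (v m) := fun m =>
    (((measurable_symPotential _).pow_const _).const_mul _).pow_const _
  set R : ℝ≥0∞ := ((κ * b : ℝ≥0) : ℝ≥0∞) ^ (q / (1 - q)) with hR
  have hRfin : R < ∞ := ENNReal.rpow_lt_top_of_nonneg (by positivity) ENNReal.coe_ne_top
  have hbound : ∀ m, ∫⁻ z in S m, v m z ∂σ ≤ R := by
    intro m
    refine (hκ.mono Measure.restrict_le_self).lintegral_rpow_le_of_subsolution hq0 hq1 hb
      (hsub (σ.restrict (S m))) ?_
    -- The potential of the truncated measure is a bounded function.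
    have hδ : (0 : ℝ) < 1 / ((m : ℝ) + 1) := by positivity
    set L : ℝ≥0∞ := ENNReal.ofReal (kernelConst n * 2 ^ (n + 1) *
      (1 / (1 / ((m : ℝ) + 1)) ^ n)) * b * σ.restrict (S m) Set.univ with hL
    have hLt : L < ∞ := ENNReal.mul_lt_top (ENNReal.mul_lt_top ENNReal.ofReal_lt_top
      ENNReal.coe_lt_top) (measure_lt_top _ _)
    have hle : ∀ z, symPotential (σ.restrict (S m)) z ≤ L := by
      intro z
      rw [symPotential_eq_lintegral, hL, ← lintegral_const]
      refine lintegral_mono_ae ?_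
      filter_upwards [ae_height_exhaustion σ m] with w hw
      rw [symKernel_comm]
      exact symKernel_le_of_height hb hδ hw z
    have hLt' : (c * L ^ (1 / (1 - q))) ^ q < ∞ :=
      ENNReal.rpow_lt_top_of_nonneg hq0.le (ENNReal.mul_lt_top ENNReal.coe_lt_top
        (ENNReal.rpow_lt_top_of_nonneg (by positivity) hLt.ne)).ne
    refine ne_top_of_le_ne_top (b := (c * L ^ (1 / (1 - q))) ^ q *
      σ.restrict (S m) Set.univ) (ENNReal.mul_lt_top hLt' (measure_lt_top _ _)).ne ?_
    rw [← lintegral_const]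
    refine lintegral_mono fun z => ?_
    gcongr
    exact hle z
  have hlim : ∀ z, Tendsto (fun m => (S m).indicator (v m) z) atTop
      (𝓝 ((c * symPotential σ z ^ (1 / (1 - q))) ^ q)) := by
    intro z
    have h1 : Tendsto (fun m => v m z) atTop
        (𝓝 ((c * symPotential σ z ^ (1 / (1 - q))) ^ q)) :=
      (ENNReal.continuous_rpow_const.tendsto _).comp (ENNReal.Tendsto.const_mul
        ((ENNReal.continuous_rpow_const.tendsto _).comp (tendsto_symPotential_exhaustion σ z))
        (Or.inr ENNReal.coe_ne_top))
    refine h1.congr' ?_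
    obtain ⟨i, hi⟩ := Set.mem_iUnion.1 ((iUnion_exhaustion σ).symm ▸ Set.mem_univ z)
    filter_upwards [eventually_ge_atTop i] with m hm
    exact (Set.indicator_of_mem (monotone_exhaustion σ hm hi) _).symm
  refine lt_of_le_of_lt ?_ hRfin
  calc ∫⁻ z, (c * symPotential σ z ^ (1 / (1 - q))) ^ q ∂σ
      = ∫⁻ z, liminf (fun m => (S m).indicator (v m) z) atTop ∂σ :=
        lintegral_congr fun z => (hlim z).liminf_eq.symm
    _ ≤ liminf (fun m => ∫⁻ z, (S m).indicator (v m) z ∂σ) atTop :=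
        lintegral_liminf_le fun m => (hvm m).indicator (measurableSet_exhaustion σ m)
    _ ≤ R := by
        refine (liminf_le_limsup).trans (limsup_le_of_le (h := Eventually.of_forall fun m => ?_))
        rw [lintegral_indicator (measurableSet_exhaustion σ m)]
        exact hbound m

/-! ### The iteration -/

lemma measurable_iterates (q : ℝ) (c₀ : ℝ≥0) (σ : Measure (HalfSpace n)) [SFinite σ] (j : ℕ) :
    Measurable (iterates q c₀ σ j) := by
  cases j with
  | zero => exact ((measurable_symPotential σ).pow_const _).const_mul _
  | succ j =>
    have : SFinite (powMeasure q σ (iterates q c₀ σ j)) := by unfold powMeasure; infer_instance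
    exact measurable_symPotential _

lemma iterates_succ (q : ℝ) (c₀ : ℝ≥0) (σ : Measure (HalfSpace n)) [SFinite σ] (j : ℕ)
    (z : HalfSpace n) :
    iterates q c₀ σ (j + 1) z = ∫⁻ w, iterates q c₀ σ j w ^ q * symKernel z w ∂σ :=
  symPotential_powMeasure (measurable_iterates q c₀ σ j).aemeasurable z

/-- Iteration from a subsolution produces a solution in `L^q(σ)`. -/
lemma exists_limit_iterates {q : ℝ} (hq0 : 0 < q) (hq1 : q < 1) {c : ℝ≥0} (hc : 0 < c)
    (hsub : ∀ (σ' : Measure (HalfSpace n)) [SigmaFinite σ'] (z : HalfSpace n),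
        (c : ℝ≥0∞) * symPotential σ' z ^ (1 / (1 - q)) ≤
          symPotential (powMeasure q σ' fun w => c * symPotential σ' w ^ (1 / (1 - q))) z)
    (σ : Measure (HalfSpace n)) [SigmaFinite σ] (hσ : CarlesonInequality q σ) :
    (∀ j z, iterates q c σ j z ≤ iterates q c σ (j + 1) z) ∧
    ∃ u : HalfSpace n → ℝ≥0∞,
      (∀ z, Tendsto (fun j => iterates q c σ j z) atTop (𝓝 (u z))) ∧
      (∀ z, u z = symPotential (powMeasure q σ u) z) ∧
      MemLp u (ENNReal.ofReal q) σ ∧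
      (∀ z, u z < ∞) ∧
      (σ ≠ 0 → ∀ z, 0 < u z) ∧
      (∀ z, (c : ℝ≥0∞) * symPotential σ z ^ (1 / (1 - q)) ≤ u z) := by
  obtain ⟨b, -, hb⟩ := exists_lintegral_pker_le n
  obtain ⟨κ, -, hκ⟩ := (carlesonInequality_iff hq0 σ).1 hσ
  have h1q : 0 < 1 - q := by linarith
  have hmono : ∀ j z, iterates q c σ j z ≤ iterates q c σ (j + 1) z := by
    intro j
    induction j with
    | zero => exact hsub σ
    | succ j ih =>
      intro z
      rw [iterates_succ, iterates_succ]
      refine lintegral_mono fun w => ?_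
      gcongr
      exact ih w
  have hmono' : ∀ z, Monotone fun j => iterates q c σ j z := fun z =>
    monotone_nat_of_le_succ fun j => hmono j z
  have hfin : ∀ j, ∫⁻ z, iterates q c σ j z ^ q ∂σ < ∞ := by
    intro j
    induction j with
    | zero => exact hκ.lintegral_symPotential_rpow_lt_top hq0 hq1 hsub
    | succ j ih =>
      have : IsFiniteMeasure (powMeasure q σ (iterates q c σ j)) :=
        isFiniteMeasure_withDensity ih.ne
      refine (hκ.lintegral_symPotential_le hq0 hb (powMeasure q σ (iterates q c σ j))).trans_lt ?_
      exact ENNReal.rpow_lt_top_of_nonneg hq0.le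
        (ENNReal.mul_lt_top ENNReal.coe_lt_top (measure_lt_top _ _)).ne
  have hbound : ∀ j, ∫⁻ z, iterates q c σ j z ^ q ∂σ ≤
      ((κ * b : ℝ≥0) : ℝ≥0∞) ^ (q / (1 - q)) := fun j =>
    hκ.lintegral_rpow_le_of_subsolution hq0 hq1 hb (hmono j) (hfin j).ne
  set u : HalfSpace n → ℝ≥0∞ := fun z => ⨆ j, iterates q c σ j z with hu
  have hum : Measurable u := Measurable.iSup fun j => measurable_iterates q c σ j
  have hlim : ∀ z, Tendsto (fun j => iterates q c σ j z) atTop (𝓝 (u z)) := fun z =>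
    tendsto_atTop_iSup (hmono' z)
  have hlimq : ∀ z, Tendsto (fun j => iterates q c σ j z ^ q) atTop (𝓝 (u z ^ q)) := fun z =>
    (ENNReal.continuous_rpow_const.tendsto _).comp (hlim z)
  have hsol : ∀ z, u z = symPotential (powMeasure q σ u) z := by
    intro z
    rw [symPotential_powMeasure hum.aemeasurable]
    refine tendsto_nhds_unique ((tendsto_add_atTop_iff_nat 1).2 (hlim z)) ?_
    simp only [iterates_succ]
    refine lintegral_tendsto_of_tendsto_of_monotone
      (fun j => (((measurable_iterates q c σ j).pow_const q).mul
        (measurable_symKernel_right z)).aemeasurable)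
      (ae_of_all _ fun w i j hij => ?_) (ae_of_all _ fun w => ?_)
    · have := hmono' w hij
      dsimp only at this ⊢
      gcongr
    · exact ENNReal.Tendsto.mul_const (hlimq w) (Or.inr (symKernel_ne_top z w))
  have huq : ∫⁻ z, u z ^ q ∂σ < ∞ := by
    refine (le_of_tendsto' (lintegral_tendsto_of_tendsto_of_monotone
      (fun j => ((measurable_iterates q c σ j).pow_const q).aemeasurable)
      (ae_of_all _ fun w i j hij => ?_) (ae_of_all _ hlimq)) hbound).trans_lt
      (ENNReal.rpow_lt_top_of_nonneg (by positivity) ENNReal.coe_ne_top)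
    exact ENNReal.rpow_le_rpow (hmono' w hij) hq0.le
  have hge : ∀ z, (c : ℝ≥0∞) * symPotential σ z ^ (1 / (1 - q)) ≤ u z := fun z =>
    le_iSup (fun j => iterates q c σ j z) 0
  have hfm : IsFiniteMeasure (powMeasure q σ u) := isFiniteMeasure_withDensity huq.ne
  refine ⟨hmono, u, hlim, hsol, (memLp_ofReal_iff hq0 σ u).2 ⟨hum.aemeasurable, huq⟩,
    fun z => ?_, fun h0 z => ?_, hge⟩
  · rw [hsol z]
    exact symPotential_lt_top _ z
  · refine lt_of_lt_of_le ?_ (hge z)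
    refine ENNReal.mul_pos (by exact_mod_cast hc.ne') (ne_of_gt ?_)
    exact ENNReal.rpow_pos_of_nonneg (symPotential_pos h0 z) (by positivity)

/-! ### From supersolutions to the Carleson inequality -/

/-- A dyadic decomposition of `∫ g^q` in terms of the distribution function of `g`. -/
lemma lintegral_rpow_le_of_weakType {α : Type*} [MeasurableSpace α] (μ : Measure α) {q : ℝ}
    (hq0 : 0 < q) {g : α → ℝ≥0∞} (hg : Measurable g) {C : ℝ≥0∞}
    (hC : ∀ k : ℕ, 2 ^ k * μ {x | 2 ^ k ≤ g x} ≤ C) :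
    ∫⁻ x, g x ^ q ∂μ ≤ μ Set.univ + 2 ^ q * C * (1 - 2 ^ (q - 1))⁻¹ := by
  have hpow : ∀ k : ℕ, ((2 : ℝ≥0∞) ^ (k + 1)) ^ q = 2 ^ q * (2 ^ (q - 1)) ^ k * 2 ^ k := by
    intro k
    rw [← ENNReal.rpow_natCast, ← ENNReal.rpow_natCast, ← ENNReal.rpow_natCast,
      ← ENNReal.rpow_mul, ← ENNReal.rpow_mul, ← ENNReal.rpow_add _ _ (by simp) (by simp),
      ← ENNReal.rpow_add _ _ (by simp) (by simp)]
    congr 1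
    push_cast
    ring
  have hms : ∀ k : ℕ, MeasurableSet {x | 2 ^ k ≤ g x} := fun k =>
    measurableSet_le measurable_const hg
  have hpt : ∀ x, g x ^ q ≤ 1 + ∑' k : ℕ,
      {x | 2 ^ k ≤ g x}.indicator (fun _ => ((2 : ℝ≥0∞) ^ (k + 1)) ^ q) x := by
    intro x
    rcases lt_or_ge (g x) 1 with h1 | h1
    · exact (ENNReal.rpow_le_one h1.le hq0.le).trans le_self_add
    rcases eq_or_ne (g x) ∞ with htop | htop
    · have : ∑' k : ℕ, {x | 2 ^ k ≤ g x}.indicator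
          (fun _ => ((2 : ℝ≥0∞) ^ (k + 1)) ^ q) x = ∞ := by
        refine top_unique ((ENNReal.tsum_const_eq_top_of_ne_zero (α := ℕ)
          one_ne_zero).symm.le.trans (ENNReal.tsum_le_tsum fun k => ?_))
        rw [Set.indicator_of_mem (by simp [htop])]
        exact ENNReal.one_le_rpow (one_le_pow₀ one_le_two) hq0
      rw [this]
      simp
    · have h1' : 1 ≤ (g x).toReal := by
        rw [← ENNReal.toReal_one]
        exact ENNReal.toReal_mono htop h1
      obtain ⟨k, hk1, hk2⟩ := exists_nat_pow_near h1' one_lt_two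
      have hgx : g x = ENNReal.ofReal (g x).toReal := (ENNReal.ofReal_toReal htop).symm
      have hpw : ∀ j : ℕ, (2 : ℝ≥0∞) ^ j = ENNReal.ofReal ((2 : ℝ) ^ j) := fun j => by
        rw [ENNReal.ofReal_pow zero_le_two]; simp
      have hk1' : 2 ^ k ≤ g x := by
        rw [hgx, hpw]; exact ENNReal.ofReal_le_ofReal hk1
      have hk2' : g x ≤ 2 ^ (k + 1) := by
        rw [hgx, hpw]; exact ENNReal.ofReal_le_ofReal hk2.le
      refine le_trans ?_ (le_add_left (ENNReal.le_tsum k))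
      rw [Set.indicator_of_mem (by exact hk1')]
      exact ENNReal.rpow_le_rpow hk2' hq0.le
  calc ∫⁻ x, g x ^ q ∂μ
      ≤ ∫⁻ x, (1 + ∑' k : ℕ,
          {x | 2 ^ k ≤ g x}.indicator (fun _ => ((2 : ℝ≥0∞) ^ (k + 1)) ^ q) x) ∂μ :=
        lintegral_mono hpt
    _ = μ Set.univ + ∑' k : ℕ, ((2 : ℝ≥0∞) ^ (k + 1)) ^ q * μ {x | 2 ^ k ≤ g x} := by
        rw [lintegral_add_left measurable_const, lintegral_one,
          lintegral_tsum fun k => (measurable_const.indicator (hms k)).aemeasurable]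
        congr 1
        exact tsum_congr fun k => lintegral_indicator_const (hms k) _
    _ ≤ μ Set.univ + ∑' k : ℕ, 2 ^ q * C * (2 ^ (q - 1)) ^ k := by
        refine add_le_add_right (ENNReal.tsum_le_tsum fun k => ?_) _
        rw [hpow]
        calc (2 : ℝ≥0∞) ^ q * (2 ^ (q - 1)) ^ k * 2 ^ k * μ {x | 2 ^ k ≤ g x}
            = 2 ^ q * (2 ^ (q - 1)) ^ k * (2 ^ k * μ {x | 2 ^ k ≤ g x}) := by ring
          _ ≤ 2 ^ q * (2 ^ (q - 1)) ^ k * C := mul_le_mul_right (hC k) _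
          _ = _ := by ring
    _ = _ := by rw [ENNReal.tsum_mul_left, ENNReal.tsum_geometric]

/-- A positive supersolution in `L^q(σ)` forces the Carleson inequality: with `μ = u^q σ`, the
quotient `Pν / u` is at most `Pν / PP*μ`, which is of weak type with respect to the finite measure
`μ`, hence in `L^q(μ)` because `q < 1`. -/
lemma IsPositiveSupersolution.carlesonInequality {q : ℝ} (hq0 : 0 < q) (hq1 : q < 1)
    {σ : Measure (HalfSpace n)} [SigmaFinite σ] {u : HalfSpace n → ℝ≥0∞}
    (hu : IsPositiveSupersolution q σ u) : CarlesonInequality q σ := by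
  obtain ⟨h, -, hh⟩ := exists_pker_le_symKernel n
  obtain ⟨hum, hufin⟩ := (memLp_ofReal_iff hq0 σ u).1 hu.memLp
  set μ := powMeasure q σ u with hμ
  have hμfin : IsFiniteMeasure μ := isFiniteMeasure_withDensity hufin.ne
  set C : ℝ≥0∞ := ENNReal.ofReal (2 ^ (2 * n + 3)) * h with hC
  set A : ℝ≥0∞ := μ Set.univ + 2 ^ q * C * (1 - 2 ^ (q - 1))⁻¹ with hA
  have hAfin : A < ∞ := by
    refine ENNReal.add_lt_top.2 ⟨measure_lt_top _ _, ENNReal.mul_lt_top (ENNReal.mul_lt_top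
      (ENNReal.rpow_lt_top_of_nonneg hq0.le (by simp))
      (ENNReal.mul_lt_top ENNReal.ofReal_lt_top ENNReal.coe_lt_top)) ?_⟩
    rw [ENNReal.inv_lt_top, tsub_pos_iff_lt]
    exact ENNReal.rpow_lt_one_of_one_lt_of_neg (by norm_num) (by linarith)
  have hpos : ∀ᵐ z ∂σ, symPotential μ z ≠ 0 := by
    by_cases h0 : μ = 0
    · have h1 := (withDensity_eq_zero_iff (hum.pow_const q)).1 h0
      filter_upwards [h1, hu.pos] with z hz hz'
      have : u z = 0 := by simpa [hq0, hq0.le, not_lt.2 hq0.le] using hz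
      exact absurd this hz'.ne'
    · exact ae_of_all _ fun z => (symPotential_pos h0 z).ne'
  refine (carlesonInequality_iff hq0 σ).2 ⟨(A ^ (1 / q)).toNNReal + 1, by positivity, ?_⟩
  intro ν _
  have hAκ : A ≤ (((A ^ (1 / q)).toNNReal + 1 : ℝ≥0) : ℝ≥0∞) ^ q := by
    have : A ^ (1 / q) ≤ (((A ^ (1 / q)).toNNReal + 1 : ℝ≥0) : ℝ≥0∞) := by
      rw [ENNReal.coe_add, ENNReal.coe_toNNReal
        (ENNReal.rpow_lt_top_of_nonneg (by positivity) hAfin.ne).ne]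
      exact le_self_add
    calc A = (A ^ (1 / q)) ^ q := by
          rw [← ENNReal.rpow_mul, one_div_mul_cancel hq0.ne', ENNReal.rpow_one]
      _ ≤ _ := ENNReal.rpow_le_rpow this hq0.le
  set N := ν Set.univ with hN
  rcases eq_or_ne N ∞ with hNt | hNt
  · rw [hNt, ENNReal.mul_top (by simp), ENNReal.top_rpow_of_pos hq0]
    exact le_top
  rcases eq_or_ne N 0 with hN0 | hN0
  · have : ν = 0 := Measure.measure_univ_eq_zero.1 hN0
    simp [poisson, this, hq0]
  set g : HalfSpace n → ℝ≥0∞ := fun z => poisson ν z / (N * symPotential μ z) with hg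
  have hgm : Measurable g :=
    (measurable_poisson ν).div ((measurable_symPotential μ).const_mul N)
  have hweak : ∀ k : ℕ, 2 ^ k * μ {z | 2 ^ k ≤ g z} ≤ C := by
    intro k
    have h1 := weakType hh μ ν (2 ^ k * N)
    have h2 : μ {z | 2 ^ k ≤ g z} ≤ μ {z | 2 ^ k * N * symPotential μ z ≤ poisson ν z} := by
      refine measure_mono fun z hz => ?_
      have := ENNReal.mul_le_of_le_div hz
      rwa [← mul_assoc] at this
    refine (ENNReal.mul_le_mul_iff_right hN0 hNt).1 ?_
    calc N * (2 ^ k * μ {z | 2 ^ k ≤ g z})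
        ≤ N * (2 ^ k * μ {z | 2 ^ k * N * symPotential μ z ≤ poisson ν z}) := by gcongr
      _ = 2 ^ k * N * μ {z | 2 ^ k * N * symPotential μ z ≤ poisson ν z} := by ring
      _ ≤ C * N := h1
      _ = N * C := mul_comm _ _
  calc ∫⁻ z, poisson ν z ^ q ∂σ ≤ ∫⁻ z, N ^ q * (u z ^ q * g z ^ q) ∂σ := by
        refine lintegral_mono_ae ?_
        filter_upwards [hpos] with z hz
        have h1 : poisson ν z = N * symPotential μ z * g z :=
          (ENNReal.mul_div_cancel (mul_ne_zero hN0 hz)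
            (ENNReal.mul_ne_top hNt (symPotential_lt_top μ z).ne)).symm
        rw [h1, ENNReal.mul_rpow_of_nonneg _ _ hq0.le, ENNReal.mul_rpow_of_nonneg _ _ hq0.le,
          mul_assoc]
        gcongr
        exact hu.le z
    _ = N ^ q * ∫⁻ z, g z ^ q ∂μ := by
        rw [lintegral_const_mul' _ _ (ENNReal.rpow_lt_top_of_nonneg hq0.le hNt).ne, hμ, powMeasure,
          lintegral_withDensity_eq_lintegral_mul₀ (hum.pow_const q)
            (hgm.pow_const q).aemeasurable]
        rfl
    _ ≤ N ^ q * A := mul_le_mul_right (lintegral_rpow_le_of_weakType μ hq0 hgm hweak) _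
    _ ≤ N ^ q * (((A ^ (1 / q)).toNNReal + 1 : ℝ≥0) : ℝ≥0∞) ^ q := mul_le_mul_right hAκ _
    _ = _ := by rw [ENNReal.mul_rpow_of_nonneg _ _ hq0.le, mul_comm]

end PoissonCarleson

end

theorem theorem4p1 (n : ℕ) (hn : 1 ≤ n) (q : ℝ) (hq0 : 0 < q) (hq1 : q < 1) :
    (∀ (σ : Measure (PoissonCarleson.HalfSpace n)) [IsLocallyFiniteMeasure σ],
      PoissonCarleson.CarlesonInequality q σ ↔
        ∃ u : PoissonCarleson.HalfSpace n → ℝ≥0∞,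
          PoissonCarleson.IsPositiveSupersolution q σ u) ∧
    ∃ c₁ : ℝ≥0, 0 < c₁ ∧ ∀ c₀ : ℝ≥0, 0 < c₀ → c₀ ≤ c₁ →
      ∀ (σ : Measure (PoissonCarleson.HalfSpace n)) [IsLocallyFiniteMeasure σ],
        PoissonCarleson.CarlesonInequality q σ →
          (∀ j z, PoissonCarleson.iterates q c₀ σ j z ≤
            PoissonCarleson.iterates q c₀ σ (j + 1) z) ∧
          ∃ u : PoissonCarleson.HalfSpace n → ℝ≥0∞,
            (∀ z, Tendsto (fun j => PoissonCarleson.iterates q c₀ σ j z) atTop (𝓝 (u z))) ∧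
            (∀ z, u z = PoissonCarleson.symPotential (PoissonCarleson.powMeasure q σ u) z) ∧
            MemLp u (ENNReal.ofReal q) σ ∧
            (∀ z, u z < ∞) ∧
            (σ ≠ 0 → ∀ z, 0 < u z) ∧
            (∀ z, (c₀ : ℝ≥0∞) * PoissonCarleson.symPotential σ z ^ (1 / (1 - q)) ≤ u z) := by
  obtain ⟨c₁, hc₁, hsub⟩ := PoissonCarleson.exists_const_subsolution n hq0 hq1
  refine ⟨fun σ _ => ⟨fun hσ => ?_, fun ⟨u, hu⟩ => hu.carlesonInequality hq0 hq1⟩, c₁, hc₁,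
    fun c₀ h0 hc₀ σ _ hσ =>
      PoissonCarleson.exists_limit_iterates hq0 hq1 h0 (hsub c₀ hc₀) σ hσ⟩
  obtain ⟨-, u, -, hsol, hmem, -, hpos, -⟩ :=
    PoissonCarleson.exists_limit_iterates hq0 hq1 hc₁ (hsub c₁ le_rfl) σ hσ
  refine ⟨u, ?_, hmem, fun z => (hsol z).ge⟩
  by_cases h0 : σ = 0
  · simp [h0]
  · exact ae_of_all _ (hpos h0)
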